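/- Let $F$ be a $k$-CNF formula with $n$ variables and $m$ clauses, i.e. a list of $m$ clauses, each a disjunction of $k$ literals on $k$ distinct variables, and let $C$ be a set of clauses of $F$ (the core); $\overline C$ denotes the set of the other clauses of $F$. Let $\gamma\ge 0$ and suppose that (i) every clause in $C$ shares variables with at most $2^k/e-1$ other clauses in $C$, and (ii) every clause in $\overline C$ shares variables with at most $\gamma\,(2^k/e-1)$ clauses in $C$. Then the following hold, where the algorithms are given $F$ and $C$ (but not $\gamma$), run on a random access machine with fair coin flips, and obey the stated time bound in the worst case, for all outcomes of the coin flips. (a) For every polynomial $q$ and every constant $c$ there is a randomized algorithm that runs in time polynomial in $n$ and $m$ and that, for every real $\theta>0$ with $\theta\, q(n+m)\ge 1$, with probability at least $1-(n+m+1)^{-c}$ produces an assignment that satisfies all clauses in $C$ and violates at most $(1+\theta)\,2^{-k}e^{\gamma}\,|\overline C|$ of the clauses in $\overline C$. (b) For every constant $c$ there is a randomized algorithm that runs in time polynomial in $n$ and $|C|$ and that, for every real $\rho>0$, with probability at least $1-\rho-(n+|C|+1)^{-c}$ produces an assignment that satisfies all clauses in $C$ and violates at most $\frac1\rho\,2^{-k}e^{\gamma}\,|\overline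 C|$ of the clauses in $\overline C$. -/

import Mathlib

open MeasureTheory

/-! ## `k`-CNF formulas -/

/-- A clause of width exactly `k` over the variables `Fin n`: a disjunction of `k` literals on
`k` distinct variables. The `a`-th literal is the variable `var a`, unnegated iff `sign a = true`. -/
structure Clause (n k : ℕ) where
  var : Fin k ↪ Fin n
  sign : Fin k → Bool

/-- The assignment `σ` satisfies the clause: some literal is true. -/
def Clause.Satisfied {n k : ℕ} (c : Clause n k) (σ : Fin n → Bool) : Prop :=
  ∃ a : Fin k, σ (c.var a) = c.sign a

instance {n k : ℕ} (c : Clause n k) (σ : Fin n → Bool) : Decidable (c.Satisfied σ) :=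
  inferInstanceAs (Decidable (∃ a : Fin k, σ (c.var a) = c.sign a))

/-- Two clauses share a variable (with any signs). -/
def Clause.SharesVar {n k : ℕ} (c c' : Clause n k) : Prop :=
  ∃ a b : Fin k, c.var a = c'.var b

instance {n k : ℕ} (c c' : Clause n k) : Decidable (c.SharesVar c') :=
  inferInstanceAs (Decidable (∃ a b : Fin k, c.var a = c'.var b))

/-- A `k`-CNF formula with `n` variables and `m` clauses (a list of clauses, so repetitions are
allowed and are counted as different clauses). -/
abbrev Formula (n m k : ℕ) : Type := Fin m → Clause n k

/-- The number of clauses of `C`, other than the clause `j` itself, that share a variable with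
the clause `j`. -/
def Formula.coreDegree {n m k : ℕ} (F : Formula n m k) (C : Finset (Fin m)) (j : Fin m) : ℕ :=
  (C.filter fun i => i ≠ j ∧ (F i).SharesVar (F j)).card

/-- The number of clauses outside `C` that `σ` violates. -/
def Formula.violatedOutside {n m k : ℕ} (F : Formula n m k) (C : Finset (Fin m))
    (σ : Fin n → Bool) : ℕ :=
  (Cᶜ.filter fun j => ¬ (F j).Satisfied σ).card

/-! ## Randomized random access machines

A structured random access machine over the natural numbers with fair coin flips and unit cost
per step. Values can grow only through addition and programs are fixed finite objects, so `t`
steps from an input of `b`-bit numbers only produce numbers of `O(b + t)` bits, and polynomial time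
on this machine is polynomial time on a probabilistic Turing machine. -/

namespace RandRAM

/-- Expressions: constants, registers, memory cells, addition, truncated subtraction and the
comparisons `<` and `=` (with value `1` or `0`). -/
inductive Expr where
  | const (c : ℕ)
  | reg (x : ℕ)
  | load (a i : Expr)
  | add (e f : Expr)
  | sub (e f : Expr)
  | lt (e f : Expr)
  | eq (e f : Expr)

/-- Programs. -/
inductive Prog where
  | skip
  | set (x : ℕ) (e : Expr)
  | store (a i e : Expr)
  | flip (x : ℕ)
  | seq (p q : Prog)
  | ite (e : Expr) (p q : Prog)
  | while (e : Expr) (p : Prog)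

/-- The machine's store: registers, and a memory of arrays (`mem a i` is entry `i` of array `a`). -/
structure Store where
  reg : ℕ → ℕ
  mem : ℕ → ℕ → ℕ

/-- The value of an expression. -/
def Expr.eval (s : Store) : Expr → ℕ
  | .const c => c
  | .reg x => s.reg x
  | .load a i => s.mem (a.eval s) (i.eval s)
  | .add e f => e.eval s + f.eval s
  | .sub e f => e.eval s - f.eval s
  | .lt e f => if e.eval s < f.eval s then 1 else 0
  | .eq e f => if e.eval s = f.eval s then 1 else 0

/-- Write a register. -/
def Store.setReg (s : Store) (x v : ℕ) : Store :=
  { s with reg := Function.update s.reg x v }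

/-- Write a memory cell. -/
def Store.setMem (s : Store) (a i v : ℕ) : Store :=
  { s with mem := Function.update s.mem a (Function.update (s.mem a) i v) }

/-- A configuration: the stack of programs that remain to be run, the store, and the coins that
have not been used yet. -/
structure Config where
  todo : List Prog
  store : Store
  coins : ℕ → Bool

/-- One step of the machine. A configuration with nothing left to run has halted and does not
change any more. -/
def step : Config → Config
  | ⟨[], s, ω⟩ => ⟨[], s, ω⟩
  | ⟨.skip :: K, s, ω⟩ => ⟨K, s, ω⟩
  | ⟨.set x e :: K, s, ω⟩ => ⟨K, s.setReg x (e.eval s), ω⟩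
  | ⟨.store a i e :: K, s, ω⟩ => ⟨K, s.setMem (a.eval s) (i.eval s) (e.eval s), ω⟩
  | ⟨.flip x :: K, s, ω⟩ => ⟨K, s.setReg x (ω 0).toNat, fun t => ω (t + 1)⟩
  | ⟨.seq p q :: K, s, ω⟩ => ⟨p :: q :: K, s, ω⟩
  | ⟨.ite e p q :: K, s, ω⟩ => ⟨(if e.eval s ≠ 0 then p else q) :: K, s, ω⟩
  | ⟨.while e p :: K, s, ω⟩ =>
      ⟨if e.eval s ≠ 0 then p :: .while e p :: K else K, s, ω⟩

/-- The configuration after `t` steps of the program `P` on the initial store `s` with the coin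
sequence `ω`. -/
def run (P : Prog) (s : Store) (ω : ℕ → Bool) (t : ℕ) : Config :=
  step^[t] ⟨[P], s, ω⟩

/-- On the initial store `s`, the program halts within `t` steps, whatever the coins are. -/
def HaltsWithin (P : Prog) (s : Store) (t : ℕ) : Prop :=
  ∀ ω : ℕ → Bool, (run P s ω t).todo = []

/-- An infinite sequence of independent fair coins. -/
noncomputable def coinMeasure : Measure (ℕ → Bool) :=
  Measure.infinitePi fun _ => (PMF.uniformOfFintype Bool).toMeasure

/-- The initial store for a formula `F` with a distinguished set of clauses `C`.
Registers `0, 1, 2, 3` hold `n`, `m`, `k`, `|C|`. Array `1` lists the indices of the clauses in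
`C` in increasing order. Arrays `2 j + 2` and `2 j + 3` hold the variables and the signs of the
literals of the clause `j`. Everything else is `0`. -/
def input {n m k : ℕ} (F : Formula n m k) (C : Finset (Fin m)) : Store where
  reg x := if x = 0 then n else if x = 1 then m else if x = 2 then k
    else if x = 3 then C.card else 0
  mem a i :=
    if a = 1 then ((C.sort (· ≤ ·)).map Fin.val).getD i 0
    else if h : 2 ≤ a ∧ (a - 2) / 2 < m ∧ i < k then
      let c := F ⟨(a - 2) / 2, h.2.1⟩
      if a % 2 = 0 then (c.var ⟨i, h.2.2⟩ : ℕ) else (c.sign ⟨i, h.2.2⟩).toNat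
    else 0

/-- The assignment that a store holds in array `0` (nonzero means true). -/
def Store.assignment (s : Store) (n : ℕ) : Fin n → Bool :=
  fun v => decide (s.mem 0 v ≠ 0)

/-- The assignment that the program `P`, on the formula `F` with distinguished clauses `C` and
with coins `ω`, has produced after `t` steps. -/
def output {n m k : ℕ} (P : Prog) (F : Formula n m k) (C : Finset (Fin m)) (t : ℕ)
    (ω : ℕ → Bool) : Fin n → Bool :=
  (run P (input F C) ω t).store.assignment n

end RandRAM

/-!
Resample violated core clauses as in the Moser–Tardos algorithm. The history of an event is a heap:
the events that can have caused it, in layers, each one sharing variables with the layer above.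
Weight every heap with top `D` by the probability of its events and by the density at the current
assignment of the values that its lowest events prescribe. When a violated clause `c` is resampled,
letting `c` fall onto the heaps from below is injective, so the sum of these weights is a
supermartingale; for `D = c` the heap that consists of `c` alone makes it drop by one on average.
With a local lemma weight `f` on the core, hence `D` holds at the end with probability at most
`P(D) ∏ (1 + f c)` over the core neighbours of `D`, and the expected number of resampling steps is
at most `∑ f c`. For `f = e 2⁻ᵏ` the first bound is `2⁻ᵏ e^γ` for a clause outside the core and the
second one is at most `|C|`, and Markov's inequality gives (b) for a single trial. For (a) the best
of polynomially many independent trials is kept.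
-/

open scoped BigOperators

section Expectation

lemma expect_prod_pi {ι : Type*} [Fintype ι] [DecidableEq ι] {κ : ι → Type*}
    [∀ i, Fintype (κ i)] (h : ∀ i, κ i → ℝ) :
    𝔼 ω : ∀ i, κ i, ∏ i, h i (ω i) = ∏ i, 𝔼 a, h i a := by
  simp only [Fintype.expect_eq_sum_div_card, Finset.prod_div_distrib, Fintype.card_pi,
    Nat.cast_prod, Finset.prod_univ_sum, Fintype.piFinset_univ]

lemma expect_fin_succ {N : ℕ} {α : Type*} [Fintype α] (f : (Fin (N + 1) → α) → ℝ) :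
    𝔼 ω, f ω = 𝔼 a, 𝔼 ω : Fin N → α, f (Fin.cons a ω) := by
  rw [← Finset.expect_product', Finset.univ_product_univ]
  exact (Fintype.expect_equiv (Fin.consEquiv fun _ => α) _ _ fun _ => rfl).symm

lemma expect_indicator_compl {α : Type*} [Fintype α] [Nonempty α] (S : Set α) :
    𝔼 a, Sᶜ.indicator (1 : α → ℝ) a = 1 - 𝔼 a, S.indicator 1 a := by
  rw [eq_sub_iff_add_eq, ← Finset.expect_add_distrib]
  simp only [Set.indicator_compl_add_self_apply, Pi.one_apply, Fintype.expect_const]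

lemma expect_indicator_le_one {α β : Type*} [Fintype α] [Nonempty α] (S : Set β) (g : α → β) :
    𝔼 a, S.indicator (1 : β → ℝ) (g a) ≤ 1 :=
  Finset.expect_le Finset.univ_nonempty fun a _ =>
    Set.indicator_le_self' (fun _ _ => zero_le_one) (g a)

end Expectation

namespace RandRAM

instance : IsProbabilityMeasure coinMeasure := by
  unfold coinMeasure
  infer_instance

lemma coinMeasure_map_comp {ι : Type*} [Fintype ι] (e : ι ↪ ℕ) :
    coinMeasure.map (fun ω i => ω (e i)) =
      Measure.pi fun _ : ι => (PMF.uniformOfFintype Bool).toMeasure := by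
  refine (Measure.pi_eq fun s hs => ?_).symm
  have hpre : (fun (ω : ℕ → Bool) i => ω (e i)) ⁻¹' Set.univ.pi s =
      Set.pi (Finset.univ.map e : Set ℕ) (Function.extend e s fun _ => Set.univ) := by
    ext ω
    simp [e.injective.extend_apply]
  rw [Measure.map_apply (by fun_prop) (MeasurableSet.univ_pi hs), hpre, coinMeasure,
    Measure.infinitePi_pi _ fun _ _ => MeasurableSet.of_discrete, Finset.prod_map]
  simp only [e.injective.extend_apply]

lemma coinMeasure_real_comp_mem {ι : Type*} [Fintype ι] [DecidableEq ι] (e : ι ↪ ℕ)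
    (S : Set (ι → Bool)) :
    coinMeasure.real {ω | (fun i => ω (e i)) ∈ S} = 𝔼 x, S.indicator 1 x := by
  have hS : MeasurableSet S := S.toFinite.measurableSet
  have h : coinMeasure.real {ω | (fun i => ω (e i)) ∈ S} =
      (coinMeasure.map fun ω i => ω (e i)).real S :=
    (map_measureReal_apply (by fun_prop) hS).symm
  rw [h, coinMeasure_map_comp, ← integral_indicator_one hS,
    integral_fintype (.of_finite), Fintype.expect_eq_sum_div_card, Finset.sum_div]
  refine Finset.sum_congr rfl fun x _ => ?_
  simp [measureReal_def, Measure.pi_singleton, div_eq_inv_mul]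

end RandRAM

/-- A partial assignment of truth values to the variables `V`. It also stands for the event that
a random assignment agrees with it. -/
abbrev PartialAssignment (V : Type*) : Type _ := V → Option Bool

namespace PartialAssignment

variable {V : Type*} (r s t : PartialAssignment V)

/-- The assignment `σ` extends `r`. -/
def Agrees (σ : V → Bool) : Prop := ∀ x, ∀ b ∈ r x, σ x = b

/-- The union of `r` and `s`, with the values of `r` where both are defined. -/
def override : PartialAssignment V := fun x => (r x).or (s x)

/-- Replace the values of `σ` on the domain of `r` by those of `ω`. -/
def resample (σ ω : V → Bool) : V → Bool := fun x => if (r x).isSome then ω x else σ x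

lemma override_assoc : (r.override s).override t = r.override (s.override t) := by
  funext x
  exact Option.or_assoc

section Fintype

variable [Fintype V]

/-- The domain of `r`. -/
def support : Finset V := {x | (r x).isSome}

/-- The probability that a uniformly random assignment agrees with `r`. -/
noncomputable def prob : ℝ := (1 / 2) ^ r.support.card

/-- The density, with respect to the uniform distribution on all assignments, of the uniform
distribution on the assignments that agree with `r`. -/
noncomputable def density (σ : V → Bool) : ℝ :=
  ∏ x, (r x).elim 1 fun b => if σ x = b then 2 else 0

variable {r s t}

@[simp]
lemma mem_support {x : V} : x ∈ r.support ↔ (r x).isSome := by simp [support]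

lemma notMem_support {x : V} : x ∉ r.support ↔ r x = none := by simp

lemma prob_pos : 0 < r.prob := by unfold prob; positivity

lemma density_nonneg (σ : V → Bool) : 0 ≤ r.density σ := by
  refine Finset.prod_nonneg fun x _ => ?_
  cases r x with
  | none => exact zero_le_one
  | some b => dsimp only [Option.elim]; positivity

lemma prob_mul_density_of_agrees {σ : V → Bool} (h : r.Agrees σ) : r.prob * r.density σ = 1 := by
  rw [prob, density, ← Finset.prod_const, support, Finset.prod_filter, ← Finset.prod_mul_distrib]
  refine Finset.prod_eq_one fun x _ => ?_
  cases hr : r x with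
  | none => simp
  | some b => simp [h x b hr]

lemma override_left_comm (h : Disjoint r.support s.support) :
    r.override (s.override t) = s.override (r.override t) := by
  funext x
  cases hr : r x with
  | none => simp [override, hr]
  | some b =>
    have hs : s x = none := notMem_support.1 (Finset.disjoint_left.1 h (by simp [hr]))
    simp [override, hr, hs]

lemma density_resample_of_disjoint (h : Disjoint r.support s.support) (σ ω : V → Bool) :
    s.density (r.resample σ ω) = s.density σ := by
  refine Finset.prod_congr rfl fun x _ => ?_
  by_cases hx : (r x).isSome
  · rw [notMem_support.1 (Finset.disjoint_left.1 h (mem_support.2 hx))]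
    rfl
  · rw [resample, if_neg hx]

lemma expect_ite_eq_two (b : Bool) : 𝔼 c : Bool, (if c = b then 2 else 0 : ℝ) = 1 := by
  rw [Fintype.expect_eq_sum_div_card, Finset.sum_ite_eq' Finset.univ b]
  norm_num

variable [DecidableEq V]

lemma expect_density : 𝔼 σ, r.density σ = 1 := by
  unfold density
  rw [expect_prod_pi fun x c => (r x).elim (1 : ℝ) fun b => if c = b then 2 else 0]
  refine Finset.prod_eq_one fun x _ => ?_
  cases r x with
  | none => simp
  | some b => simpa using expect_ite_eq_two b

lemma expect_density_resample {σ : V → Bool} (h : r.Agrees σ) :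
    𝔼 ω, s.density (r.resample σ ω) = r.prob * (r.override s).density σ := by
  unfold density resample
  rw [expect_prod_pi fun x c => (s x).elim (1 : ℝ) fun b =>
      if (if (r x).isSome then c else σ x) = b then 2 else 0,
    prob, ← Finset.prod_const, support, Finset.prod_filter, ← Finset.prod_mul_distrib]
  refine Finset.prod_congr rfl fun x _ => ?_
  cases hr : r x with
  | none => cases hs : s x <;> simp [override, hr, hs]
  | some b =>
    have hσ := h x b hr
    cases hs : s x with
    | none => simp [override, hr, hσ]
    | some b' => simpa [override, hr, hσ] using expect_ite_eq_two b'

end Fintype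

end PartialAssignment

namespace MoserTardos

open PartialAssignment

section Heaps

variable {V ι : Type*}

open scoped Classical in
/-- The values that the events in `S` prescribe, where `true` wins a conflict. (Conflicts do occur,
since the layers of a heap need not be independent sets.) -/
noncomputable def layerValue (β : ι → PartialAssignment V) (S : Finset ι) :
    PartialAssignment V := fun x =>
  if ∃ c ∈ S, (β c x).isSome then some (decide (∃ c ∈ S, β c x = some true)) else none

/-- The values that the layers of a heap prescribe, where a lower layer has priority. -/
noncomputable def prescribed (β : ι → PartialAssignment V) : List (Finset ι) → PartialAssignment V
  | [] => fun _ => none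
  | S :: H => (prescribed β H).override (layerValue β S)

lemma layerValue_singleton (β : ι → PartialAssignment V) (c : ι) : layerValue β {c} = β c := by
  funext x
  cases h : β c x with
  | none => simp [layerValue, h]
  | some b => cases b <;> simp [layerValue, h]

variable [Fintype V]

section Adjacency

variable (β : ι → PartialAssignment V) (C : Finset ι)

/-- The events `c` and `c'` are equal or share a variable. -/
def Adj (c c' : ι) : Prop := c = c' ∨ ¬ Disjoint (β c).support (β c').support

/-- Some member of `S` is adjacent to `c`. -/
def Linked (S : Finset ι) (c : ι) : Prop := ∃ c' ∈ S, Adj β c' c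

open scoped Classical in
/-- The inclusive neighbourhood of `S` in `C`. -/
noncomputable def nbhd (S : Finset ι) : Finset ι := C.filter (Linked β S)

/-- The probability that independent copies of the events in all the layers of a heap occur. -/
noncomputable def weight (H : List (Finset ι)) : ℝ :=
  (H.map fun S => ∏ c ∈ S, (β c).prob).prod

end Adjacency

variable {β : ι → PartialAssignment V} {C S T : Finset ι} {c D : ι} {H H' : List (Finset ι)}
  {r : ℕ} {σ : V → Bool}

lemma mem_nbhd : c ∈ nbhd β C S ↔ c ∈ C ∧ Linked β S c := by
  simp [nbhd]

lemma nbhd_subset (S : Finset ι) : nbhd β C S ⊆ C := fun _ h => (mem_nbhd.1 h).1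

lemma nbhd_empty : nbhd β C ∅ = ∅ := by
  ext
  simp [mem_nbhd, Linked]

lemma linked_of_mem (h : c ∈ S) : Linked β S c := ⟨c, h, Or.inl rfl⟩

lemma Linked.mono (h : Linked β S c) (hST : S ⊆ T) : Linked β T c :=
  let ⟨c', hc', hadj⟩ := h
  ⟨c', hST hc', hadj⟩

lemma nbhd_mono (h : S ⊆ T) : nbhd β C S ⊆ nbhd β C T := fun _ hx =>
  mem_nbhd.2 ⟨(mem_nbhd.1 hx).1, (mem_nbhd.1 hx).2.mono h⟩

lemma weight_cons (S : Finset ι) (H : List (Finset ι)) :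
    weight β (S :: H) = (∏ c ∈ S, (β c).prob) * weight β H := List.prod_cons

lemma weight_nonneg (H : List (Finset ι)) : 0 ≤ weight β H :=
  List.prod_nonneg fun p hp => by
    obtain ⟨S, -, rfl⟩ := List.mem_map.1 hp
    exact Finset.prod_nonneg fun c _ => prob_pos.le

lemma weight_mul_density_nonneg (H : List (Finset ι)) (σ : V → Bool) :
    0 ≤ weight β H * (prescribed β H).density σ :=
  mul_nonneg (weight_nonneg H) (density_nonneg σ)

lemma weight_mul_density_singleton (h : (β D).Agrees σ) :
    weight β [{D}] * (prescribed β [{D}]).density σ = 1 := by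
  have hpre : prescribed β [{D}] = β D := by
    funext x
    simp [prescribed, override, layerValue_singleton]
  have hweight : weight β [{D}] = (β D).prob := by simp [weight]
  rw [hpre, hweight, prob_mul_density_of_agrees h]

lemma disjoint_support_layerValue (h : ¬ Linked β S c) :
    Disjoint (β c).support (layerValue β S).support := by
  refine Finset.disjoint_left.2 fun x hx hxS => h ?_
  obtain ⟨c', hc', hx'⟩ : ∃ c' ∈ S, (β c' x).isSome := by
    by_contra hne
    simp [layerValue, hne] at hxS
  exact ⟨c', hc', .inr (Finset.not_disjoint_iff.2 ⟨x, mem_support.2 hx', hx⟩)⟩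

lemma disjoint_support_prescribed (h : ¬ ∃ T ∈ H, Linked β T c) :
    Disjoint (β c).support (prescribed β H).support := by
  induction H with
  | nil => exact Finset.disjoint_left.2 fun x _ hx => by simp [prescribed] at hx
  | cons S H ih =>
    simp only [List.mem_cons, exists_eq_or_imp, not_or] at h
    refine Finset.disjoint_left.2 fun x hx => ?_
    have h1 := Finset.disjoint_left.1 (ih h.2) hx
    have h2 := Finset.disjoint_left.1 (disjoint_support_layerValue h.1) hx
    rw [notMem_support] at h1 h2 ⊢
    simp [prescribed, override, h1, h2]

section DecidableEq

variable [DecidableEq ι]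

section Defs

variable (β C)

/-- The heaps with top layer `S` (the empty heap if `S = ∅`) and at most `r` layers, all of them
nonempty. A heap is the list of its layers, top first; every event below the top layer belongs
to `C` and is adjacent to an event in the layer directly above it. -/
noncomputable def heaps : ℕ → Finset ι → Finset (List (Finset ι))
  | 0, S => if S = ∅ then {[]} else ∅
  | r + 1, S => if S = ∅ then {[]} else
      (nbhd β C S).powerset.biUnion fun T => (heaps r T).image (List.cons S)

open scoped Classical in
/-- Let the event `c` fall from below onto a heap: it comes to rest in the layer directly below the
lowest layer that it is linked to. -/
noncomputable def deposit (c : ι) : List (Finset ι) → List (Finset ι)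
  | [] => [{c}]
  | S :: H => if ∃ T ∈ S :: H, Linked β T c then S :: deposit c H else insert c S :: H

open scoped Classical in
/-- Extend a heap by `c` at the bottom if it is linked to `c`. -/
noncomputable def push (c : ι) (H : List (Finset ι)) : List (Finset ι) :=
  if ∃ T ∈ H, Linked β T c then deposit β c H else H

/-- The sum over the heaps with top `D` and at most `r` layers of the density, at `σ`, of the event
that `σ` is the random assignment from which a run of the process with this heap starts. -/
noncomputable def potential (r : ℕ) (D : ι) (σ : V → Bool) : ℝ :=
  ∑ H ∈ heaps β C r {D}, weight β H * (prescribed β H).density σ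

end Defs

lemma mem_heaps_succ : H ∈ heaps β C (r + 1) S ↔
    S = ∅ ∧ H = [] ∨ S ≠ ∅ ∧ ∃ T ⊆ nbhd β C S, ∃ H' ∈ heaps β C r T, H = S :: H' := by
  rw [heaps]
  split_ifs with hS <;> simp [hS, eq_comm]

lemma heaps_empty : heaps β C r ∅ = {[]} := by
  cases r <;> simp [heaps]

lemma nil_mem_heaps : [] ∈ heaps β C r ∅ := by simp [heaps_empty]

lemma heaps_mono_succ (r : ℕ) (S : Finset ι) : heaps β C r S ⊆ heaps β C (r + 1) S := by
  induction r generalizing S with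
  | zero =>
    intro H hH
    obtain ⟨rfl, rfl⟩ : S = ∅ ∧ H = [] := by
      by_cases hS : S = ∅ <;> simp_all [heaps]
    exact nil_mem_heaps
  | succ r ih =>
    intro H hH
    rw [mem_heaps_succ] at hH ⊢
    exact hH.imp_right fun ⟨hS, T, hT, H', hH', h⟩ => ⟨hS, T, hT, H', ih T hH', h⟩

lemma headD_of_mem_heaps (h : H ∈ heaps β C r S) : H.headD ∅ = S := by
  cases r with
  | zero => by_cases hS : S = ∅ <;> simp_all [heaps]
  | succ r =>
    rcases mem_heaps_succ.1 h with ⟨rfl, rfl⟩ | ⟨-, -, -, H', -, rfl⟩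
    exacts [rfl, rfl]

lemma sum_heaps_succ (hS : S ≠ ∅) (r : ℕ) (g : List (Finset ι) → ℝ) :
    ∑ H ∈ heaps β C (r + 1) S, g H =
      ∑ T ∈ (nbhd β C S).powerset, ∑ H ∈ heaps β C r T, g (S :: H) := by
  have hdisj : ((nbhd β C S).powerset : Set (Finset ι)).PairwiseDisjoint
      fun T => (heaps β C r T).image (List.cons S) := by
    refine fun T _ T' _ hne => Finset.disjoint_left.2 fun H h h' => hne ?_
    obtain ⟨H₁, h₁, rfl⟩ := Finset.mem_image.1 h
    obtain ⟨H₂, h₂, he⟩ := Finset.mem_image.1 h'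
    rw [← headD_of_mem_heaps h₁, ← headD_of_mem_heaps h₂, List.cons_injective he]
  rw [heaps, if_neg hS, Finset.sum_biUnion hdisj]
  exact Finset.sum_congr rfl fun T _ => Finset.sum_image List.cons_injective.injOn

lemma empty_notMem_of_mem_heaps (h : H ∈ heaps β C r S) : ∅ ∉ H := by
  induction r generalizing S H with
  | zero => by_cases hS : S = ∅ <;> simp_all [heaps]
  | succ r ih =>
    rcases mem_heaps_succ.1 h with ⟨-, rfl⟩ | ⟨hS, T, -, H', hH', rfl⟩
    · exact List.not_mem_nil
    · simpa [hS.symm] using ih hH'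

lemma singleton_mem_heaps (r : ℕ) : [{c}] ∈ heaps β C (r + 1) {c} :=
  mem_heaps_succ.2 (.inr ⟨Finset.singleton_ne_empty c, ∅, Finset.empty_subset _, [],
    nil_mem_heaps, rfl⟩)

section Deposit

lemma deposit_cons_of_linked (h : ∃ T ∈ S :: H, Linked β T c) :
    deposit β c (S :: H) = S :: deposit β c H := by
  rw [deposit, if_pos h]

lemma deposit_of_not_linked (h : ¬ ∃ T ∈ S :: H, Linked β T c) :
    deposit β c (S :: H) = insert c S :: H := by
  rw [deposit, if_neg h]

lemma deposit_ne_nil (c : ι) (H : List (Finset ι)) : deposit β c H ≠ [] := by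
  cases H with
  | nil => exact List.cons_ne_nil _ _
  | cons S H => unfold deposit; split_ifs <;> exact List.cons_ne_nil _ _

lemma exists_mem_deposit (c : ι) (H : List (Finset ι)) : ∃ T ∈ deposit β c H, c ∈ T := by
  induction H with
  | nil => exact ⟨{c}, List.mem_singleton_self _, Finset.mem_singleton_self c⟩
  | cons S H ih =>
    unfold deposit
    split_ifs
    · exact ih.imp fun T hT => ⟨List.mem_cons_of_mem _ hT.1, hT.2⟩
    · exact ⟨_, List.mem_cons_self, Finset.mem_insert_self _ _⟩

lemma linked_deposit (c : ι) (H : List (Finset ι)) : ∃ T ∈ deposit β c H, Linked β T c :=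
  (exists_mem_deposit c H).imp fun _ hT => ⟨hT.1, linked_of_mem hT.2⟩

lemma eq_nil_of_deposit_eq_singleton (hH : ∅ ∉ H) (h : deposit β c H = [{c}]) : H = [] := by
  cases H with
  | nil => rfl
  | cons S H =>
    by_cases hl : ∃ T ∈ S :: H, Linked β T c
    · rw [deposit_cons_of_linked hl, List.cons.injEq] at h
      exact absurd h.2 (deposit_ne_nil c H)
    · rw [deposit_of_not_linked hl, List.cons.injEq] at h
      have hc : c ∉ S := fun hc => hl ⟨S, List.mem_cons_self, linked_of_mem hc⟩
      have hS : S = ∅ := by rw [← Finset.erase_insert hc, h.1, Finset.erase_singleton]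
      exact absurd (hS ▸ List.mem_cons_self) hH

lemma deposit_inj (hH : ∅ ∉ H) (hH' : ∅ ∉ H') (h : deposit β c H = deposit β c H') : H = H' := by
  induction H generalizing H' with
  | nil => exact (eq_nil_of_deposit_eq_singleton hH' h.symm).symm
  | cons S H ih =>
    cases H' with
    | nil => exact eq_nil_of_deposit_eq_singleton hH h
    | cons S' H' =>
      by_cases hl : ∃ T ∈ S :: H, Linked β T c <;> by_cases hl' : ∃ T ∈ S' :: H', Linked β T c
      · rw [deposit_cons_of_linked hl, deposit_cons_of_linked hl', List.cons.injEq] at h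
        rw [h.1, ih (fun h' => hH (.tail _ h')) (fun h' => hH' (.tail _ h')) h.2]
      · rw [deposit_cons_of_linked hl, deposit_of_not_linked hl', List.cons.injEq] at h
        obtain ⟨T, hT, hTc⟩ := linked_deposit (β := β) c H
        exact absurd ⟨T, .tail _ (h.2 ▸ hT), hTc⟩ hl'
      · rw [deposit_of_not_linked hl, deposit_cons_of_linked hl', List.cons.injEq] at h
        obtain ⟨T, hT, hTc⟩ := linked_deposit (β := β) c H'
        exact absurd ⟨T, .tail _ (h.2 ▸ hT), hTc⟩ hl
      · rw [deposit_of_not_linked hl, deposit_of_not_linked hl', List.cons.injEq] at h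
        have hc : c ∉ S := fun hc => hl ⟨S, List.mem_cons_self, linked_of_mem hc⟩
        have hc' : c ∉ S' := fun hc => hl' ⟨S', List.mem_cons_self, linked_of_mem hc⟩
        rw [← Finset.erase_insert hc, h.1, Finset.erase_insert hc', h.2]

lemma push_inj (hH : ∅ ∉ H) (hH' : ∅ ∉ H') (h : push β c H = push β c H') : H = H' := by
  unfold push at h
  split_ifs at h with hl hl' hl'
  · exact deposit_inj hH hH' h
  · exact absurd (h ▸ linked_deposit c H) hl'
  · exact absurd (h ▸ linked_deposit c H') hl
  · exact h

lemma deposit_mem_heaps_of_not_linked (hH : H ∈ heaps β C r S) (h : ¬ ∃ T ∈ H, Linked β T c) :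
    deposit β c H ∈ heaps β C (r + 1) (insert c S) := by
  rcases mem_heaps_succ.1 (heaps_mono_succ r S hH) with ⟨rfl, rfl⟩ | ⟨-, T, hT, H', hH', rfl⟩
  · exact singleton_mem_heaps r
  · exact mem_heaps_succ.2 (.inr ⟨Finset.insert_ne_empty c S, T,
      hT.trans (nbhd_mono (Finset.subset_insert c S)), H', hH', deposit_of_not_linked h⟩)

lemma deposit_mem_heaps (hc : c ∈ C) (hH : H ∈ heaps β C r S) (h : ∃ T ∈ H, Linked β T c) :
    deposit β c H ∈ heaps β C (r + 1) S := by
  induction r generalizing S H with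
  | zero =>
    obtain ⟨T, hT, -⟩ := h
    by_cases hS : S = ∅ <;> simp_all [heaps]
  | succ r ih =>
    rcases mem_heaps_succ.1 hH with ⟨-, rfl⟩ | ⟨hS, T, hT, H', hH', rfl⟩
    · obtain ⟨T, hT, -⟩ := h
      exact absurd hT List.not_mem_nil
    rw [deposit_cons_of_linked h, mem_heaps_succ]
    by_cases hl : ∃ T ∈ H', Linked β T c
    · exact .inr ⟨hS, T, hT, _, ih hH' hl, rfl⟩
    · have hSc : Linked β S c := by simpa [hl] using h
      exact .inr ⟨hS, insert c T, Finset.insert_subset (mem_nbhd.2 ⟨hc, hSc⟩) hT, _,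
        deposit_mem_heaps_of_not_linked hH' hl, rfl⟩

lemma push_mem_heaps (hc : c ∈ C) (hH : H ∈ heaps β C r S) :
    push β c H ∈ heaps β C (r + 1) S := by
  unfold push
  split_ifs with h
  exacts [deposit_mem_heaps hc hH h, heaps_mono_succ r S hH]

lemma weight_deposit (c : ι) (H : List (Finset ι)) :
    weight β (deposit β c H) = (β c).prob * weight β H := by
  induction H with
  | nil => simp [deposit, weight]
  | cons S H ih =>
    by_cases h : ∃ T ∈ S :: H, Linked β T c
    · rw [deposit_cons_of_linked h, weight_cons, ih, weight_cons, mul_left_comm]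
    · have hc : c ∉ S := fun hc => h ⟨S, List.mem_cons_self, linked_of_mem hc⟩
      rw [deposit_of_not_linked h, weight_cons, Finset.prod_insert hc, weight_cons, mul_assoc]

lemma layerValue_insert (h : ¬ Linked β S c) :
    layerValue β (insert c S) = (β c).override (layerValue β S) := by
  funext x
  cases hx : β c x with
  | none => simp [layerValue, override, hx]
  | some b =>
    have hS : ∀ c' ∈ S, β c' x = none := fun c' hc' => notMem_support.1 fun hx' =>
      h ⟨c', hc', .inr (Finset.not_disjoint_iff.2 ⟨x, hx', by simp [hx]⟩)⟩
    have hS' : ¬ ∃ c' ∈ S, β c' x = some true := fun ⟨c', hc', h'⟩ => by simp [hS c' hc'] at h'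
    cases b <;> simp [layerValue, override, hx, hS']

lemma prescribed_deposit (c : ι) (H : List (Finset ι)) :
    prescribed β (deposit β c H) = (β c).override (prescribed β H) := by
  induction H with
  | nil =>
    funext x
    simp [deposit, prescribed, override, layerValue_singleton]
  | cons S H ih =>
    by_cases h : ∃ T ∈ S :: H, Linked β T c
    · rw [deposit_cons_of_linked h, prescribed, ih, override_assoc, prescribed]
    · rw [deposit_of_not_linked h]
      simp only [List.mem_cons, exists_eq_or_imp, not_or] at h
      rw [prescribed, layerValue_insert h.1, prescribed,
        override_left_comm (disjoint_support_prescribed h.2)]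

end Deposit

section Potential

lemma potential_nonneg : 0 ≤ potential β C r D σ :=
  Finset.sum_nonneg fun H _ => weight_mul_density_nonneg H σ

lemma potential_le_succ : potential β C r D σ ≤ potential β C (r + 1) D σ :=
  Finset.sum_le_sum_of_subset_of_nonneg (heaps_mono_succ r {D}) fun H _ _ =>
    weight_mul_density_nonneg H σ

lemma one_le_potential (h : (β D).Agrees σ) : 1 ≤ potential β C (r + 1) D σ := by
  rw [← weight_mul_density_singleton h]
  exact Finset.single_le_sum (fun H _ => weight_mul_density_nonneg H σ) (singleton_mem_heaps r)

lemma push_ne_singleton (h : H ∈ heaps β C r {c}) : push β c H ≠ [{c}] := by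
  cases H with
  | nil => simpa using headD_of_mem_heaps h
  | cons S H =>
    obtain rfl : S = {c} := headD_of_mem_heaps h
    have hl : ∃ T ∈ {c} :: H, Linked β T c :=
      ⟨{c}, List.mem_cons_self, linked_of_mem (Finset.mem_singleton_self c)⟩
    rw [push, if_pos hl, deposit_cons_of_linked hl, ne_eq, List.cons.injEq, not_and]
    exact fun _ => deposit_ne_nil c H

variable [DecidableEq V]

lemma expect_weight_mul_density_resample (h : (β c).Agrees σ) (H : List (Finset ι)) :
    𝔼 ω, weight β H * (prescribed β H).density ((β c).resample σ ω) =
      weight β (push β c H) * (prescribed β (push β c H)).density σ := by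
  rw [← Finset.mul_expect]
  by_cases hl : ∃ T ∈ H, Linked β T c
  · rw [push, if_pos hl, expect_density_resample h, weight_deposit, prescribed_deposit,
      mul_assoc, mul_left_comm]
  · simp only [push, if_neg hl, density_resample_of_disjoint (disjoint_support_prescribed hl),
      Fintype.expect_const]

/-- Pushing the resampled event maps the heaps with top `D` injectively to heaps with top `D`. If
`c = D`, the heap `[{D}]` is not in the image and contributes `1`. -/
lemma expect_potential_resample_le (hc : c ∈ C) (h : (β c).Agrees σ) (r : ℕ) (D : ι) :
    (if c = D then 1 else 0) + 𝔼 ω, potential β C r D ((β c).resample σ ω) ≤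
      potential β C (r + 1) D σ := by
  have himage : (heaps β C r {D}).image (push β c) ⊆ heaps β C (r + 1) {D} :=
    Finset.image_subset_iff.2 fun H hH => push_mem_heaps hc hH
  have hexpect : 𝔼 ω, potential β C r D ((β c).resample σ ω) =
      ∑ H ∈ (heaps β C r {D}).image (push β c), weight β H * (prescribed β H).density σ := by
    unfold potential
    rw [Finset.expect_sum_comm, Finset.sum_image fun H hH H' hH' => push_inj
      (empty_notMem_of_mem_heaps hH) (empty_notMem_of_mem_heaps hH')]
    exact Finset.sum_congr rfl fun H _ => expect_weight_mul_density_resample h H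
  rw [hexpect]
  split_ifs with hcD
  · subst hcD
    have hnew : [{c}] ∉ (heaps β C r {c}).image (push β c) := fun hmem =>
      let ⟨H, hH, he⟩ := Finset.mem_image.1 hmem
      push_ne_singleton hH he
    rw [← weight_mul_density_singleton h, ← Finset.sum_insert
      (f := fun H => weight β H * (prescribed β H).density σ) hnew]
    exact Finset.sum_le_sum_of_subset_of_nonneg
      (Finset.insert_subset (singleton_mem_heaps r) himage) fun H _ _ =>
        weight_mul_density_nonneg H σ
  · rw [zero_add]
    exact Finset.sum_le_sum_of_subset_of_nonneg himage fun H _ _ => weight_mul_density_nonneg H σ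

end Potential

end DecidableEq

section LocalLemma

/-- The condition of the Lovász local lemma for the events in `C`. The weights `f c` are related to
the usual ones by `x c = f c / (1 + f c)`. -/
structure LocalLemmaCondition (β : ι → PartialAssignment V) (C : Finset ι) (f : ι → ℝ) :
    Prop where
  nonneg : ∀ c ∈ C, 0 ≤ f c
  prob_mul_prod_le : ∀ c ∈ C, (β c).prob * ∏ c' ∈ nbhd β C {c}, (1 + f c') ≤ f c

namespace LocalLemmaCondition

variable {f : ι → ℝ} (hf : LocalLemmaCondition β C f)

include hf

lemma one_le_prod_one_add (hT : T ⊆ C) : 1 ≤ ∏ c ∈ T, (1 + f c) :=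
  Finset.one_le_prod fun c hc => le_add_of_nonneg_right (hf.nonneg c (hT hc))

lemma prod_nbhd_le (T : Finset ι) :
    ∏ c ∈ nbhd β C T, (1 + f c) ≤ ∏ c ∈ T, ∏ c' ∈ nbhd β C {c}, (1 + f c') := by
  classical
  induction T using Finset.induction_on with
  | empty => simp [nbhd_empty]
  | insert c T hc ih =>
    have hunion : nbhd β C (insert c T) = nbhd β C {c} ∪ nbhd β C T := by
      ext c'
      simp [mem_nbhd, Linked, and_or_left]
    rw [Finset.prod_insert hc, hunion]
    calc ∏ c' ∈ nbhd β C {c} ∪ nbhd β C T, (1 + f c')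
        ≤ (∏ c' ∈ nbhd β C {c} ∪ nbhd β C T, (1 + f c')) *
            ∏ c' ∈ nbhd β C {c} ∩ nbhd β C T, (1 + f c') :=
          le_mul_of_one_le_right
            (zero_le_one.trans (hf.one_le_prod_one_add
              (Finset.union_subset (nbhd_subset _) (nbhd_subset _))))
            (hf.one_le_prod_one_add (Finset.inter_subset_left.trans (nbhd_subset _)))
      _ = (∏ c' ∈ nbhd β C {c}, (1 + f c')) * ∏ c' ∈ nbhd β C T, (1 + f c') :=
          Finset.prod_union_inter
      _ ≤ _ := mul_le_mul_of_nonneg_left ih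
          (zero_le_one.trans (hf.one_le_prod_one_add (nbhd_subset _)))

lemma prod_prob_mul_prod_nbhd_le (hT : T ⊆ C) :
    (∏ c ∈ T, (β c).prob) * ∏ c ∈ nbhd β C T, (1 + f c) ≤ ∏ c ∈ T, f c :=
  calc (∏ c ∈ T, (β c).prob) * ∏ c ∈ nbhd β C T, (1 + f c)
      ≤ (∏ c ∈ T, (β c).prob) * ∏ c ∈ T, ∏ c' ∈ nbhd β C {c}, (1 + f c') :=
        mul_le_mul_of_nonneg_left (hf.prod_nbhd_le T) (Finset.prod_nonneg fun _ _ => prob_pos.le)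
    _ = ∏ c ∈ T, (β c).prob * ∏ c' ∈ nbhd β C {c}, (1 + f c') := Finset.prod_mul_distrib.symm
    _ ≤ ∏ c ∈ T, f c := Finset.prod_le_prod
        (fun _ _ => mul_nonneg prob_pos.le
          (zero_le_one.trans (hf.one_le_prod_one_add (nbhd_subset _))))
        fun c hc => hf.prob_mul_prod_le c (hT hc)

lemma sum_weight_heaps_le [DecidableEq ι] (r : ℕ) (S : Finset ι) :
    ∑ H ∈ heaps β C r S, weight β H ≤
      (∏ c ∈ S, (β c).prob) * ∏ c ∈ nbhd β C S, (1 + f c) := by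
  induction r generalizing S with
  | zero =>
    by_cases hS : S = ∅
    · simp [hS, heaps, weight, nbhd_empty]
    · rw [heaps, if_neg hS, Finset.sum_empty]
      exact mul_nonneg (Finset.prod_nonneg fun _ _ => prob_pos.le)
        (zero_le_one.trans (hf.one_le_prod_one_add (nbhd_subset S)))
  | succ r ih =>
    by_cases hS : S = ∅
    · simp [hS, heaps, weight, nbhd_empty]
    calc ∑ H ∈ heaps β C (r + 1) S, weight β H
        = (∏ c ∈ S, (β c).prob) *
            ∑ T ∈ (nbhd β C S).powerset, ∑ H ∈ heaps β C r T, weight β H := by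
          simp only [sum_heaps_succ hS, weight_cons, Finset.mul_sum]
      _ ≤ (∏ c ∈ S, (β c).prob) * ∑ T ∈ (nbhd β C S).powerset, ∏ c ∈ T, f c := by
          refine mul_le_mul_of_nonneg_left (Finset.sum_le_sum fun T hT => ?_)
            (Finset.prod_nonneg fun _ _ => prob_pos.le)
          exact (ih T).trans (hf.prod_prob_mul_prod_nbhd_le
            ((Finset.mem_powerset.1 hT).trans (nbhd_subset S)))
      _ = _ := by rw [Finset.prod_one_add]

lemma expect_potential_le [DecidableEq ι] [DecidableEq V] (r : ℕ) (D : ι) :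
    𝔼 σ, potential β C r D σ ≤ (β D).prob * ∏ c ∈ nbhd β C {D}, (1 + f c) := by
  unfold potential
  rw [Finset.expect_sum_comm]
  simp_rw [← Finset.mul_expect, expect_density, mul_one]
  simpa using hf.sum_weight_heaps_le r {D}

end LocalLemmaCondition

end LocalLemma

end Heaps

section Run

variable {V ι : Type*} (β : ι → PartialAssignment V) (sel : (V → Bool) → Option ι)

/-- One step of the Moser–Tardos algorithm with selection rule `sel`, where `ω` holds the fresh
values. -/
def resampleStep (σ ω : V → Bool) : V → Bool :=
  (sel σ).elim σ fun c => (β c).resample σ ω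

/-- The Moser–Tardos algorithm after `N` steps from the assignment `σ`. -/
def process {N : ℕ} (σ : V → Bool) (ω : Fin N → V → Bool) : V → Bool :=
  (List.ofFn ω).foldl (resampleStep β sel) σ

/-- The Moser–Tardos algorithm after `N` steps, where the first row of `ω` is the initial
assignment. -/
def trial {N : ℕ} (ω : Fin (N + 1) → V → Bool) : V → Bool :=
  process β sel (ω 0) (Fin.tail ω)

/-- The selection rule only selects events of `C` that occur. -/
def IsSound (C : Finset ι) : Prop := ∀ σ, ∀ c ∈ sel σ, c ∈ C ∧ (β c).Agrees σ

variable {β sel} {C : Finset ι} {σ : V → Bool} {c : ι}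

lemma resampleStep_of_sel_eq_some (h : sel σ = some c) :
    resampleStep β sel σ = (β c).resample σ := by
  funext ω
  rw [resampleStep, h, Option.elim_some]

lemma process_of_sel_eq_none (h : sel σ = none) {N : ℕ} (ω : Fin N → V → Bool) :
    process β sel σ ω = σ := by
  unfold process
  induction List.ofFn ω with
  | nil => rfl
  | cons a l ih => rwa [List.foldl_cons, resampleStep, h, Option.elim_none]

variable [Fintype V] [DecidableEq V]

lemma expect_process_succ (σ : V → Bool) (N : ℕ) (g : (V → Bool) → ℝ) :
    𝔼 ω : Fin (N + 1) → V → Bool, g (process β sel σ ω) =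
      𝔼 a, 𝔼 ω : Fin N → V → Bool, g (process β sel (resampleStep β sel σ a) ω) := by
  rw [expect_fin_succ]
  simp [process, List.ofFn_succ]

lemma expect_trial (N : ℕ) (g : (V → Bool) → ℝ) :
    𝔼 ω : Fin (N + 1) → V → Bool, g (trial β sel ω) =
      𝔼 σ, 𝔼 ω : Fin N → V → Bool, g (process β sel σ ω) := by
  rw [expect_fin_succ]
  simp [trial]

lemma expect_agrees_process_le [DecidableEq ι] (hsel : IsSound β sel C) (D : ι) (N : ℕ)
    (σ : V → Bool) :
    𝔼 ω : Fin N → V → Bool, {τ | (β D).Agrees τ}.indicator 1 (process β sel σ ω) ≤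
      potential β C (N + 1) D σ := by
  induction N generalizing σ with
  | zero =>
    by_cases h : (β D).Agrees σ
    · simpa [process, h] using one_le_potential h
    · simpa [process, h] using potential_nonneg
  | succ N ih =>
    rw [expect_process_succ]
    refine (Finset.expect_le_expect fun a _ => ih _).trans ?_
    unfold resampleStep
    cases hσ : sel σ with
    | none => simpa using potential_le_succ
    | some c =>
      obtain ⟨hcC, hc⟩ := hsel σ c hσ
      refine le_trans (le_add_of_nonneg_left ?_) (expect_potential_resample_le hcC hc (N + 1) D)
      positivity

/-- Every step at which some event is selected is paid for by a drop of the total potential. -/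
lemma expect_alive_process_le [DecidableEq ι] (hsel : IsSound β sel C) (N : ℕ) (σ : V → Bool) :
    N * 𝔼 ω : Fin N → V → Bool, {τ | sel τ ≠ none}.indicator 1 (process β sel σ ω) ≤
      ∑ D ∈ C, potential β C N D σ := by
  induction N generalizing σ with
  | zero => simpa using Finset.sum_nonneg fun D _ => potential_nonneg
  | succ N ih =>
    cases hσ : sel σ with
    | none =>
      simpa [process_of_sel_eq_none hσ, hσ] using Finset.sum_nonneg fun D _ => potential_nonneg
    | some c =>
      obtain ⟨hcC, hc⟩ := hsel σ c hσ
      rw [expect_process_succ, resampleStep_of_sel_eq_some hσ]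
      set p : (V → Bool) → ℝ := fun a =>
        𝔼 ω : Fin N → V → Bool, {τ | sel τ ≠ none}.indicator 1
          (process β sel ((β c).resample σ a) ω)
      have hp_le_one : 𝔼 a, p a ≤ 1 :=
        Finset.expect_le Finset.univ_nonempty fun a _ => expect_indicator_le_one _ _
      have hstep : N * 𝔼 a, p a ≤
          𝔼 a, ∑ D ∈ C, potential β C N D ((β c).resample σ a) := by
        rw [Finset.mul_expect]
        exact Finset.expect_le_expect fun a _ => ih _
      calc ((N + 1 : ℕ) : ℝ) * 𝔼 a, p a = 𝔼 a, p a + N * 𝔼 a, p a := by push_cast; ring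
        _ ≤ 1 + 𝔼 a, ∑ D ∈ C, potential β C N D ((β c).resample σ a) :=
            add_le_add hp_le_one hstep
        _ = ∑ D ∈ C, ((if c = D then 1 else 0) +
              𝔼 a, potential β C N D ((β c).resample σ a)) := by
            rw [Finset.sum_add_distrib, Finset.sum_ite_eq, if_pos hcC, Finset.expect_sum_comm]
        _ ≤ _ := Finset.sum_le_sum fun D _ => expect_potential_resample_le hcC hc N D

variable {f : ι → ℝ}

theorem expect_agrees_trial_le (hf : LocalLemmaCondition β C f) (hsel : IsSound β sel C) (D : ι)
    (N : ℕ) :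
    𝔼 ω : Fin (N + 1) → V → Bool, {σ | (β D).Agrees σ}.indicator 1 (trial β sel ω) ≤
      (β D).prob * ∏ c ∈ nbhd β C {D}, (1 + f c) := by
  classical
  rw [expect_trial]
  exact (Finset.expect_le_expect fun σ _ => expect_agrees_process_le hsel D N σ).trans
    (hf.expect_potential_le (N + 1) D)

theorem expect_alive_trial_le (hf : LocalLemmaCondition β C f) (hsel : IsSound β sel C) (N : ℕ) :
    N * 𝔼 ω : Fin (N + 1) → V → Bool, {σ | sel σ ≠ none}.indicator 1 (trial β sel ω) ≤
      ∑ D ∈ C, f D := by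
  classical
  rw [expect_trial, Finset.mul_expect]
  refine (Finset.expect_le_expect fun σ _ => expect_alive_process_le hsel N σ).trans ?_
  rw [Finset.expect_sum_comm]
  exact Finset.sum_le_sum fun D hD =>
    (hf.expect_potential_le N D).trans (hf.prob_mul_prod_le D hD)

end Run

end MoserTardos

namespace RandRAM

/-- The coins that remain after `d` flips. -/
def drop (d : ℕ) (ω : ℕ → Bool) : ℕ → Bool := fun t => ω (t + d)

lemma drop_zero (ω : ℕ → Bool) : drop 0 ω = ω := rfl

lemma drop_drop (d d' : ℕ) (ω : ℕ → Bool) : drop d' (drop d ω) = drop (d + d') ω := by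
  funext t
  exact congrArg ω (by omega)

section Frame

/-- The stores `s` and `s'` agree on the registers below `b` and on all arrays except array `0`. -/
structure Frame (b : ℕ) (s s' : Store) : Prop where
  reg_of_lt : ∀ x < b, s'.reg x = s.reg x
  mem : ∀ a ≠ 0, s'.mem a = s.mem a

variable {b b' x i v : ℕ} {s s' s'' : Store}

namespace Frame

lemma refl (b : ℕ) (s : Store) : Frame b s s := ⟨fun _ _ => rfl, fun _ _ => rfl⟩

lemma trans (h : Frame b s s') (h' : Frame b s' s'') : Frame b s s'' :=
  ⟨fun x hx => (h'.reg_of_lt x hx).trans (h.reg_of_lt x hx),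
    fun a ha => (h'.mem a ha).trans (h.mem a ha)⟩

lemma mono (h : Frame b s s') (hb : b' ≤ b := by decide) : Frame b' s s' :=
  ⟨fun x hx => h.reg_of_lt x (hx.trans_le hb), h.mem⟩

lemma reg (h : Frame b s s') (x : ℕ) (hx : x < b := by decide) : s'.reg x = s.reg x :=
  h.reg_of_lt x hx

lemma setReg (hx : b ≤ x) : Frame b s (s.setReg x v) :=
  ⟨fun _ hy => Function.update_of_ne (hy.trans_le hx).ne _ _, fun _ _ => rfl⟩

lemma setMem : Frame b s (s.setMem 0 i v) :=
  ⟨fun _ _ => rfl, fun _ ha => Function.update_of_ne ha _ _⟩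

end Frame

@[simp]
lemma setReg_reg_self (s : Store) (x v : ℕ) : (s.setReg x v).reg x = v :=
  Function.update_self _ _ _

lemma setReg_reg_of_ne {y : ℕ} (h : y ≠ x) : (s.setReg x v).reg y = s.reg y :=
  Function.update_of_ne h _ _

end Frame

/-- Started in `s` with coins `ω`, the program `P` halts within `t` steps, uses `d` coins, changes
neither the registers below `b` nor the arrays other than array `0`, and reaches a store that
satisfies `Q`. -/
def Spec (b : ℕ) (P : Prog) (s : Store) (ω : ℕ → Bool) (t d : ℕ) (Q : Store → Prop) : Prop :=
  ∃ s' t', t' ≤ t ∧ Frame b s s' ∧ Q s' ∧ ∀ K, step^[t'] ⟨P :: K, s, ω⟩ = ⟨K, s', drop d ω⟩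

section Rules

variable {P p q : Prog} {s : Store} {ω : ℕ → Bool} {b b' b₁ b₂ x y t t' t₁ t₂ d d' d₁ d₂ : ℕ}
  {e : Expr} {Q Q₁ Q' : Store → Prop}

lemma Spec.imp (h : Spec b P s ω t d Q) (hQ : ∀ s', Frame b s s' → Q s' → Q' s') :
    Spec b P s ω t d Q' := by
  obtain ⟨s', t₀, ht₀, hf, hs', hrun⟩ := h
  exact ⟨s', t₀, ht₀, hf, hQ _ hf hs', hrun⟩

lemma Spec.mono (h : Spec b P s ω t d Q) (hb : b' ≤ b := by decide) (ht : t ≤ t' := by omega)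
    (hd : d = d' := by omega) : Spec b' P s ω t' d' Q := by
  obtain ⟨s', t₀, ht₀, hf, hs', hrun⟩ := h
  exact ⟨s', t₀, ht₀.trans ht, hf.mono hb, hs', hd ▸ hrun⟩

lemma Spec.of_step (hstep : ∀ K, step ⟨P :: K, s, ω⟩ = ⟨p :: K, s, ω⟩) (h : Spec b p s ω t d Q) :
    Spec b P s ω (t + 1) d Q := by
  obtain ⟨s', t₀, ht₀, hf, hs', hrun⟩ := h
  refine ⟨s', t₀ + 1, by omega, hf, hs', fun K => ?_⟩
  rw [Function.iterate_succ_apply, hstep, hrun]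

lemma Spec.of_step_pair (hstep : ∀ K, step ⟨P :: K, s, ω⟩ = ⟨p :: q :: K, s, ω⟩)
    (hp : Spec b₁ p s ω t₁ d₁ Q₁)
    (hq : ∀ s', Frame b₁ s s' → Q₁ s' → Spec b₂ q s' (drop d₁ ω) t₂ d₂ Q)
    (hb₁ : b ≤ b₁) (hb₂ : b ≤ b₂) : Spec b P s ω (t₁ + t₂ + 1) (d₁ + d₂) Q := by
  obtain ⟨s₁, a₁, ha₁, hf₁, hs₁, hrun₁⟩ := hp
  obtain ⟨s₂, a₂, ha₂, hf₂, hs₂, hrun₂⟩ := hq s₁ hf₁ hs₁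
  refine ⟨s₂, a₂ + (a₁ + 1), by omega, (hf₁.mono hb₁).trans (hf₂.mono hb₂), hs₂, fun K => ?_⟩
  rw [Function.iterate_add_apply, Function.iterate_succ_apply, hstep, hrun₁, hrun₂, drop_drop]

lemma spec_skip (h : Q s) : Spec b .skip s ω 1 0 Q :=
  ⟨s, 1, le_rfl, .refl _ _, h, fun _ => rfl⟩

lemma spec_set (h : Q (s.setReg x (e.eval s))) (hx : b ≤ x := by decide) :
    Spec b (.set x e) s ω 1 0 Q :=
  ⟨_, 1, le_rfl, .setReg hx, h, fun _ => rfl⟩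

lemma spec_flip (h : Q (s.setReg x (ω 0).toNat)) (hx : b ≤ x := by decide) :
    Spec b (.flip x) s ω 1 1 Q :=
  ⟨_, 1, le_rfl, .setReg hx, h, fun _ => rfl⟩

lemma spec_store {i : Expr} (h : Q (s.setMem 0 (i.eval s) (e.eval s))) :
    Spec b (.store (.const 0) i e) s ω 1 0 Q :=
  ⟨_, 1, le_rfl, .setMem, h, fun _ => rfl⟩

lemma spec_seq (hp : Spec b₁ p s ω t₁ d₁ Q₁)
    (hq : ∀ s', Frame b₁ s s' → Q₁ s' → Spec b₂ q s' (drop d₁ ω) t₂ d₂ Q)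
    (hb₁ : b ≤ b₁ := by decide) (hb₂ : b ≤ b₂ := by decide) :
    Spec b (.seq p q) s ω (t₁ + t₂ + 1) (d₁ + d₂) Q :=
  .of_step_pair (fun _ => rfl) hp hq hb₁ hb₂

lemma spec_set_seq (h : Spec b q (s.setReg x (e.eval s)) ω t d Q) (hx : b ≤ x := by decide) :
    Spec b (.seq (.set x e) q) s ω (t + 2) d Q :=
  (spec_seq (b := b) (Q₁ := (· = s.setReg x (e.eval s))) (spec_set rfl hx)
    (fun _ _ hs' => hs' ▸ h) le_rfl le_rfl).mono le_rfl

lemma spec_ite (h₁ : e.eval s ≠ 0 → Spec b p s ω t d Q) (h₂ : e.eval s = 0 → Spec b q s ω t d Q) :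
    Spec b (.ite e p q) s ω (t + 1) d Q := by
  by_cases he : e.eval s = 0
  · exact .of_step (fun _ => by simp only [step, he, ne_eq, not_true_eq_false, if_false]) (h₂ he)
  · exact .of_step (fun _ => by simp only [step, if_pos he]) (h₁ he)

lemma spec_while_of_eq_zero (he : e.eval s = 0) (h : Q s) : Spec b (.while e p) s ω 1 0 Q :=
  ⟨s, 1, le_rfl, .refl _ _, h, fun _ => by
    rw [Function.iterate_one, drop_zero, step, if_neg (not_not.2 he)]⟩

lemma spec_while_of_ne_zero (he : e.eval s ≠ 0) (hp : Spec b p s ω t₁ d₁ Q₁)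
    (hq : ∀ s', Frame b s s' → Q₁ s' → Spec b (.while e p) s' (drop d₁ ω) t₂ d₂ Q) :
    Spec b (.while e p) s ω (t₁ + t₂ + 1) (d₁ + d₂) Q :=
  .of_step_pair (fun _ => by simp only [step, if_pos he]) hp hq le_rfl le_rfl

/-- Repeat `body`, incrementing register `x` each time, while it is less than register `y`. -/
def countUp (x y : ℕ) (body : Prog) : Prog :=
  .while (.lt (.reg x) (.reg y)) (.seq body (.set x (.add (.reg x) (.const 1))))

/-- Run `body` with register `x` counting from `0` up to the value of register `y`. -/
def forLoop (x y : ℕ) (body : Prog) : Prog := .seq (.set x (.const 0)) (countUp x y body)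

variable {L : ℕ} {I : ℕ → Store → Prop}

lemma spec_countUp (hxy : y < x) (hI : ∀ j s' v, I j s' → I j (s'.setReg x v))
    (hbody : ∀ j < L, ∀ s', Frame x s s' → s'.reg x = j → I j s' →
      Spec (x + 1) p s' (drop (d * j) ω) t d (I (j + 1)))
    (hy : s.reg y = L) (r : ℕ) {j : ℕ} {s' : Store} (hj : j + r = L) (hf : Frame x s s')
    (hx : s'.reg x = j) (hs' : I j s') :
    Spec x (countUp x y p) s' (drop (d * j) ω) (r * (t + 3) + 1) (d * r) (I L) := by
  have hguard : (Expr.lt (.reg x) (.reg y)).eval s' = if j < L then 1 else 0 := by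
    simp only [Expr.eval, hx, hf.reg y hxy, hy]
  induction r generalizing j s' with
  | zero =>
    have hjL : ¬j < L := by omega
    exact (spec_while_of_eq_zero (hguard.trans (if_neg hjL)) (by rwa [← hj])).mono le_rfl
  | succ r ih =>
    have hjL : j < L := by omega
    have hround : Spec x (.seq p (.set x (.add (.reg x) (.const 1)))) s' (drop (d * j) ω) (t + 2) d
        fun s'' => s''.reg x = j + 1 ∧ I (j + 1) s'' := by
      refine spec_seq (hbody j hjL s' hf hx hs')
        (fun s₁ hf₁ hs₁ => spec_set ⟨?_, hI _ _ _ hs₁⟩ le_rfl) (Nat.le_succ x) le_rfl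
      simp only [setReg_reg_self, Expr.eval, hf₁.reg x (Nat.lt_succ_self x), hx]
    refine (spec_while_of_ne_zero (by rw [hguard, if_pos hjL]; exact one_ne_zero) hround
      fun s₂ hf₂ hs₂ => ?_).mono le_rfl (t := t + 2 + (r * (t + 3) + 1) + 1) (d := d + d * r)
        (by ring_nf; omega) (by ring)
    have hs₂' := ih (by omega) (hf.trans hf₂) hs₂.1 hs₂.2
      (by simp only [Expr.eval, hs₂.1, (hf.trans hf₂).reg y hxy, hy])
    rwa [drop_drop]

lemma spec_forLoop (hbody : ∀ j < L, ∀ s', Frame x s s' → s'.reg x = j → I j s' →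
      Spec (x + 1) p s' (drop (d * j) ω) t d (I (j + 1)))
    (hI : ∀ j s' v, I j s' → I j (s'.setReg x v)) (h0 : I 0 s) (hy : s.reg y = L)
    (hxy : y < x := by decide) :
    Spec x (forLoop x y p) s ω (L * (t + 3) + 3) (d * L) (I L) := by
  have hf : Frame x s (s.setReg x 0) := .setReg le_rfl
  exact spec_set_seq (spec_countUp hxy hI hbody hy L (zero_add L) hf (setReg_reg_self _ _ _)
    (hI _ _ _ h0)) le_rfl

lemma Spec.run_eq (h : Spec b P s ω t d Q) :
    ∃ s', Q s' ∧ ∀ T, t ≤ T → run P s ω T = ⟨[], s', drop d ω⟩ := by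
  obtain ⟨s', t₀, ht₀, -, hQ, hrun⟩ := h
  refine ⟨s', hQ, fun T hT => ?_⟩
  obtain ⟨r, rfl⟩ : ∃ r, T = r + t₀ := ⟨T - t₀, by omega⟩
  rw [run, Function.iterate_add_apply, hrun]
  exact Function.iterate_fixed rfl r

end Rules

-- A loop leaves the registers below its counter alone, so counters precede the registers that
-- the loop bodies use.
namespace Reg

abbrev n : ℕ := 0
abbrev m : ℕ := 1
abbrev k : ℕ := 2
abbrev coreSize : ℕ := 3
abbrev base : ℕ := 4
abbrev steps : ℕ := 5
abbrev attempt : ℕ := 6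
abbrev best : ℕ := 7
abbrev round : ℕ := 8
abbrev clauseIndex : ℕ := 9
abbrev found : ℕ := 10
abbrev count : ℕ := 11
abbrev clause : ℕ := 12
abbrev index : ℕ := 13
abbrev literal : ℕ := 14
abbrev flag : ℕ := 15
abbrev coin : ℕ := 16
abbrev product : ℕ := 17

end Reg

section Input

variable {n m k : ℕ} {F : Formula n m k} {C : Finset (Fin m)} {s s' : Store} {b : ℕ}

/-- The store still holds the input in the registers `0`–`3` and in the arrays other than `0`. -/
def HasInput (F : Formula n m k) (C : Finset (Fin m)) (s : Store) : Prop :=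
  Frame Reg.base (input F C) s

lemma HasInput.frame (hs : HasInput F C s) (h : Frame b s s') (hb : Reg.base ≤ b := by decide) :
    HasInput F C s' :=
  hs.trans (h.mono hb)

lemma HasInput.reg_n (hs : HasInput F C s) : s.reg Reg.n = n := hs.reg Reg.n

lemma HasInput.reg_m (hs : HasInput F C s) : s.reg Reg.m = m := hs.reg Reg.m

lemma HasInput.reg_k (hs : HasInput F C s) : s.reg Reg.k = k := hs.reg Reg.k

lemma HasInput.reg_coreSize (hs : HasInput F C s) : s.reg Reg.coreSize = C.card :=
  hs.reg Reg.coreSize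

/-- The variable of the literal `a` of the clause `j`. -/
def literalVar (j a : Expr) : Expr := .load (.add (.add j j) (.const 2)) a

/-- The sign of the literal `a` of the clause `j`. -/
def literalSign (j a : Expr) : Expr := .load (.add (.add j j) (.const 3)) a

/-- The index of the `i`-th core clause. -/
def coreClause (i : Expr) : Expr := .load (.const 1) i

lemma eval_literalVar (hs : HasInput F C s) {j a : Expr} {c : Fin m} {l : Fin k}
    (hj : j.eval s = c) (ha : a.eval s = l) : (literalVar j a).eval s = (F c).var l := by
  have hc : ((c : ℕ) + c + 2 - 2) / 2 = c := by omega
  have hlt : 2 ≤ (c : ℕ) + c + 2 ∧ (c : ℕ) < m ∧ (l : ℕ) < k := ⟨by omega, c.2, l.2⟩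
  have heven : ((c : ℕ) + c + 2) % 2 = 0 := by omega
  simp only [literalVar, Expr.eval, hj, ha, hs.mem (c + c + 2) (by omega), input,
    if_neg (show (c : ℕ) + c + 2 ≠ 1 by omega), dif_pos hlt, if_pos heven, hc, Fin.eta]

lemma eval_literalSign (hs : HasInput F C s) {j a : Expr} {c : Fin m} {l : Fin k}
    (hj : j.eval s = c) (ha : a.eval s = l) :
    (literalSign j a).eval s = ((F c).sign l).toNat := by
  have hc : ((c : ℕ) + c + 3 - 2) / 2 = c := by omega
  have hlt : 2 ≤ (c : ℕ) + c + 3 ∧ (c : ℕ) < m ∧ (l : ℕ) < k := ⟨by omega, c.2, l.2⟩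
  have hodd : ((c : ℕ) + c + 3) % 2 ≠ 0 := by omega
  simp only [literalSign, Expr.eval, hj, ha, hs.mem (c + c + 3) (by omega), input,
    if_neg (show (c : ℕ) + c + 3 ≠ 1 by omega), dif_pos hlt, if_neg hodd, hc, Fin.eta]

lemma eval_coreClause (hs : HasInput F C s) {i : Expr} {x : ℕ}
    (hx : x < (C.sort (· ≤ ·)).length) (hi : i.eval s = x) :
    (coreClause i).eval s = (C.sort (· ≤ ·))[x] := by
  simp only [coreClause, Expr.eval, hi, hs.mem 1 one_ne_zero, input, if_true]
  rw [List.getD_eq_getElem _ _ (by simpa using hx), List.getElem_map]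

end Input

section Blocks

variable {n m k b b' t d x : ℕ} {F : Formula n m k} {C : Finset (Fin m)} {s s' : Store}
  {ω : ℕ → Bool} {σ : Fin n → Bool} {e i : Expr} {p : Prog} {Q : Store → Prop}

/-- The `b`-th of the consecutive blocks of `n` cells into which array `0` is cut. Block `0` holds
the current assignment, block `1` the fresh coins, block `2` the best assignment so far. -/
def Store.block (s : Store) (n b : ℕ) : Fin n → ℕ := fun v => s.mem 0 (b * n + v)

/-- The assignment `σ` is stored in block `b`. -/
def Holds (s : Store) (b : ℕ) (σ : Fin n → Bool) : Prop := s.block n b = fun v => (σ v).toNat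

lemma block_congr (h : s'.mem = s.mem) : s'.block n b = s.block n b := by
  unfold Store.block
  rw [h]

lemma block_setMem_self (s : Store) (v : Fin n) (x : ℕ) :
    (s.setMem 0 (b * n + v) x).block n b = Function.update (s.block n b) v x := by
  funext w
  rcases eq_or_ne w v with rfl | hw
  · simp only [Store.block, Store.setMem, Function.update_self]
  · have hne : b * n + w ≠ b * n + v := fun h => hw (Fin.ext (Nat.add_left_cancel h))
    simp only [Store.block, Store.setMem, Function.update_self, Function.update_of_ne hne,
      Function.update_of_ne hw]

lemma block_setMem_of_ne (s : Store) (v : Fin n) (x : ℕ) (hb : b' ≠ b) :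
    (s.setMem 0 (b * n + v) x).block n b' = s.block n b' := by
  funext w
  have hne : b' * n + w ≠ b * n + v := fun h => hb <| by
    simpa [Nat.mul_add_div (Nat.zero_lt_of_lt v.2), mul_comm _ n, Nat.div_eq_of_lt]
      using congrArg (· / n) h
  simp only [Store.block, Store.setMem, Function.update_self, Function.update_of_ne hne]

/-- The index in array `0` at which block `b` starts. -/
def blockStart : ℕ → Expr
  | 0 => .const 0
  | b + 1 => .add (blockStart b) (.reg Reg.n)

lemma eval_blockStart (s : Store) (b : ℕ) : (blockStart b).eval s = b * s.reg Reg.n := by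
  induction b with
  | zero => rw [zero_mul]; rfl
  | succ b ih => rw [blockStart, Expr.eval, ih, Expr.eval, Nat.succ_mul]

/-- The entry `i` of block `b`. -/
def cell (b : ℕ) (i : Expr) : Expr := .load (.const 0) (.add (blockStart b) i)

/-- Write the entry `i` of block `b`. -/
def setCell (b : ℕ) (i e : Expr) : Prog := .store (.const 0) (.add (blockStart b) i) e

lemma eval_cell {v : Fin n} (hn : s.reg Reg.n = n) (hi : i.eval s = v) :
    (cell b i).eval s = s.block n b v := by
  simp only [cell, Expr.eval, eval_blockStart, hn, hi, Store.block]

lemma spec_setCell {v : Fin n} (hn : s.reg Reg.n = n) (hi : i.eval s = v)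
    (h : Q (s.setMem 0 (b' * n + v) (e.eval s))) : Spec b (setCell b' i e) s ω 1 0 Q := by
  refine spec_store ?_
  simpa only [Expr.eval, eval_blockStart, hn, hi] using h

/-- Fill block `b`: its entry number `Reg.index` becomes the value of `e` after running `p`. -/
def fill (b : ℕ) (p : Prog) (e : Expr) : Prog :=
  forLoop Reg.index Reg.n (.seq p (setCell b (.reg Reg.index) e))

lemma spec_fill {val : Fin n → ℕ} (hs : HasInput F C s)
    (hp : ∀ (v : Fin n) (s'), Frame Reg.index s s' → s'.reg Reg.index = v →
      (∀ b' ≠ b, s'.block n b' = s.block n b') →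
      Spec (Reg.index + 1) p s' (drop (d * v) ω) t d fun s'' =>
        s''.mem = s'.mem ∧ e.eval s'' = val v) :
    Spec Reg.index (fill b p e) s ω (n * (t + 5) + 3) (d * n) fun s' =>
      s'.block n b = val ∧ ∀ b' ≠ b, s'.block n b' = s.block n b' := by
  refine Spec.imp (spec_forLoop (t := t + 2) (d := d) (L := n) (I := fun j s' =>
    (∀ v : Fin n, (v : ℕ) < j → s'.block n b v = val v) ∧
      ∀ b' ≠ b, s'.block n b' = s.block n b') ?_ (fun _ _ _ h => h)
    ⟨fun v hv => absurd hv (Nat.not_lt_zero v), fun _ _ => rfl⟩ hs.reg_n) fun s' _ h =>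
      ⟨funext fun v => h.1 v v.2, h.2⟩
  rintro j hj s₁ hf₁ hidx ⟨hval, hother⟩
  refine spec_seq (t₂ := 1) (d₂ := 0) (b₂ := Reg.index + 1) (hp ⟨j, hj⟩ s₁ hf₁ hidx hother)
    fun s₂ hf₂ ⟨hmem, he⟩ => ?_
  refine spec_setCell (v := ⟨j, hj⟩) (hs.frame (hf₁.trans hf₂.mono)).reg_n
    ((hf₂.reg Reg.index).trans hidx) ⟨fun v hv => ?_, fun b' hb' => ?_⟩
  · rw [block_setMem_self, he, block_congr hmem]
    rcases eq_or_ne v ⟨j, hj⟩ with rfl | hvj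
    · exact Function.update_self _ _ _
    · rw [Function.update_of_ne hvj]
      exact hval v (lt_of_le_of_ne (Nat.lt_succ_iff.1 hv) fun h => hvj (Fin.ext h))
  · rw [block_setMem_of_ne _ _ _ hb', block_congr hmem, hother b' hb']

/-- Fill block `b` with fresh coins. -/
def flipBlock (b : ℕ) : Prog := fill b (.flip Reg.coin) (.reg Reg.coin)

lemma spec_flipBlock (hs : HasInput F C s) :
    Spec Reg.index (flipBlock b) s ω (6 * n + 3) n fun s' =>
      Holds s' b (fun v : Fin n => ω v) ∧ ∀ b' ≠ b, s'.block n b' = s.block n b' := by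
  refine (spec_fill (t := 1) (d := 1) hs fun v s' _ _ _ => ?_).mono
  refine spec_flip ⟨rfl, ?_⟩
  rw [Expr.eval, setReg_reg_self, one_mul, drop, zero_add]

/-- Copy block `src` to block `dst`. -/
def copyBlock (src dst : ℕ) : Prog := fill dst .skip (cell src (.reg Reg.index))

lemma spec_copyBlock {src dst : ℕ} (hs : HasInput F C s) (hne : src ≠ dst) :
    Spec Reg.index (copyBlock src dst) s ω (6 * n + 3) 0 fun s' =>
      s'.block n dst = s.block n src ∧ ∀ b' ≠ dst, s'.block n b' = s.block n b' := by
  refine (spec_fill (t := 1) (d := 0) hs fun v s' hf hidx hother => ?_).mono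
  refine spec_skip ⟨rfl, ?_⟩
  rw [eval_cell (i := .reg Reg.index) (hs.frame hf).reg_n hidx, hother src hne]

end Blocks

end RandRAM

section Falsifier

variable {n m k : ℕ}

namespace Clause

/-- The partial assignment that makes all the literals of the clause false. -/
noncomputable def falsifier (c : Clause n k) : PartialAssignment (Fin n) :=
  Function.extend c.var (fun a => some !c.sign a) fun _ => none

variable {c c' : Clause n k}

lemma falsifier_var (a : Fin k) : c.falsifier (c.var a) = some !c.sign a :=
  c.var.injective.extend_apply _ _ a

lemma isSome_falsifier {x : Fin n} : (c.falsifier x).isSome ↔ ∃ a, c.var a = x := by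
  constructor
  · contrapose!
    intro h
    rw [falsifier, Function.extend_apply' _ _ _ (not_exists.2 h)]
    exact Bool.false_ne_true
  · rintro ⟨a, rfl⟩
    rw [falsifier_var, Option.isSome_some]

lemma agrees_falsifier {σ : Fin n → Bool} : c.falsifier.Agrees σ ↔ ¬c.Satisfied σ := by
  rw [Satisfied, not_exists]
  constructor
  · intro h a
    exact Bool.eq_not.1 (h (c.var a) _ (falsifier_var a))
  · intro h x b hb
    obtain ⟨a, rfl⟩ := isSome_falsifier.1 (Option.isSome_of_mem hb)
    rw [falsifier_var, Option.mem_some_iff] at hb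
    exact hb ▸ Bool.eq_not.2 (h a)

lemma support_falsifier : c.falsifier.support = Finset.univ.map c.var := by
  ext x
  simp [isSome_falsifier]

lemma prob_falsifier : c.falsifier.prob = ((2 : ℝ) ^ k)⁻¹ := by
  rw [PartialAssignment.prob, support_falsifier, Finset.card_map, Finset.card_univ,
    Fintype.card_fin, one_div, inv_pow]

lemma disjoint_support_falsifier :
    Disjoint c.falsifier.support c'.falsifier.support ↔ ¬c.SharesVar c' := by
  simp only [support_falsifier, Finset.disjoint_left, Finset.mem_map, Finset.mem_univ, true_and,
    SharesVar, forall_exists_index, forall_apply_eq_imp_iff, not_exists]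
  exact forall₂_congr fun a b => not_congr eq_comm

end Clause

variable (F : Formula n m k) (C : Finset (Fin m))

/-- The last clause in a list that `σ` violates. -/
def lastViolated (l : List (Fin m)) (σ : Fin n → Bool) : Option (Fin m) :=
  l.reverse.find? fun j => ¬(F j).Satisfied σ

lemma lastViolated_concat (l : List (Fin m)) (j : Fin m) (σ : Fin n → Bool) :
    lastViolated F (l ++ [j]) σ = if (F j).Satisfied σ then lastViolated F l σ else some j := by
  rw [lastViolated, List.reverse_concat, List.find?_cons]
  by_cases h : (F j).Satisfied σ <;> simp [h, lastViolated]

/-- The violated clause of the core that is resampled next. -/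
def selected (σ : Fin n → Bool) : Option (Fin m) := lastViolated F (C.sort (· ≤ ·)) σ

lemma selected_eq_none {σ : Fin n → Bool} :
    selected F C σ = none ↔ ∀ j ∈ C, (F j).Satisfied σ := by
  simp [selected, lastViolated]

lemma isSound_selected : MoserTardos.IsSound (fun j => (F j).falsifier) (selected F C) C := by
  intro σ j hj
  have hmem := List.mem_of_find?_eq_some hj
  have hviol := List.find?_some hj
  exact ⟨by simpa using hmem, Clause.agrees_falsifier.2 (by simpa using hviol)⟩

end Falsifier

namespace RandRAM

section Search

variable {n m k : ℕ} {F : Formula n m k} {C : Finset (Fin m)} {s : Store} {ω : ℕ → Bool}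
  {σ : Fin n → Bool}

/-- Whether the literal `a` of the clause `j` is true. -/
def literalTrue (j a : Expr) : Expr := .eq (cell 0 (literalVar j a)) (literalSign j a)

lemma eval_literalTrue_eq_zero (hs : HasInput F C s) (hσ : Holds s 0 σ) {j a : Expr} {c : Fin m}
    {l : Fin k} (hj : j.eval s = c) (ha : a.eval s = l) :
    (literalTrue j a).eval s = 0 ↔ σ ((F c).var l) ≠ (F c).sign l := by
  rw [literalTrue, Expr.eval, eval_cell hs.reg_n (eval_literalVar hs hj ha), hσ,
    eval_literalSign hs hj ha]
  beta_reduce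
  cases σ ((F c).var l) <;> cases (F c).sign l <;> decide

lemma exists_fin_lt_succ {i : ℕ} (hi : i < k) {p : Fin k → Prop} :
    (∃ a : Fin k, (a : ℕ) < i + 1 ∧ p a) ↔ (∃ a : Fin k, (a : ℕ) < i ∧ p a) ∨ p ⟨i, hi⟩ := by
  simp only [Nat.lt_succ_iff_lt_or_eq, or_and_right, exists_or]
  refine or_congr_right ⟨?_, fun h => ⟨⟨i, hi⟩, rfl, h⟩⟩
  rintro ⟨a, rfl, ha⟩
  exact ha

lemma width_le (F : Formula n m k) (j : Fin m) : k ≤ n := by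
  simpa using Fintype.card_le_of_embedding (F j).var

/-- Set `Reg.flag` to `1` if the clause number `Reg.clause` is violated, and to `0` otherwise. -/
def evalClause : Prog :=
  .seq (.set Reg.flag (.const 1)) (forLoop Reg.literal Reg.k
    (.ite (literalTrue (.reg Reg.clause) (.reg Reg.literal)) (.set Reg.flag (.const 0)) .skip))

lemma spec_evalClause {j : Fin m} (hs : HasInput F C s) (hσ : Holds s 0 σ)
    (hj : s.reg Reg.clause = j) :
    Spec Reg.literal evalClause s ω (5 * n + 5) 0 fun s' =>
      s'.mem = s.mem ∧ s'.reg Reg.flag = if (F j).Satisfied σ then 0 else 1 := by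
  let I : ℕ → Store → Prop := fun i s' => s'.mem = s.mem ∧ s'.reg Reg.flag =
    if ∃ a : Fin k, (a : ℕ) < i ∧ σ ((F j).var a) = (F j).sign a then 0 else 1
  have hf : Frame Reg.literal s (s.setReg Reg.flag 1) := .setReg (by decide)
  have hk := Nat.mul_le_mul_right 5 (width_le F j)
  refine Spec.mono (b := Reg.literal) (t := k * (2 + 3) + 3 + 2) (d := 0 * k)
    (spec_set_seq (Spec.imp (Q := I k) (spec_forLoop ?_
      (fun i s' v h => ⟨h.1, (setReg_reg_of_ne (by decide)).trans h.2⟩) ⟨rfl, ?_⟩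
      (hs.frame hf).reg_k) fun s' _ h => ⟨h.1, ?_⟩))
  · rintro i hi s' hf' hlit ⟨hmem, hflag⟩
    have htrue := eval_literalTrue_eq_zero (hs.frame (hf.trans hf')) ((block_congr hmem).trans hσ)
      (j := .reg Reg.clause) (a := .reg Reg.literal) (c := j) (l := ⟨i, hi⟩)
      (((hf.trans hf').reg Reg.clause).trans hj) hlit
    refine spec_ite (fun h => spec_set ⟨hmem, ?_⟩) fun h => spec_skip ⟨hmem, ?_⟩
    · rw [if_pos ((exists_fin_lt_succ hi).2 (.inr (not_not.1 (mt htrue.2 h)))), setReg_reg_self,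
        Expr.eval]
    · simp only [exists_fin_lt_succ hi, htrue.1 h, or_false, hflag]
  · simp [Expr.eval]
  · rw [h.2]
    exact if_congr ⟨fun ⟨a, _, ha⟩ => ⟨a, ha⟩, fun ⟨a, ha⟩ => ⟨a, a.2, ha⟩⟩ rfl rfl

/-- Run `p` after evaluating the clause number `e`. -/
def testClause (e : Expr) (p : Prog) : Prog := .seq (.set Reg.clause e) (.seq evalClause p)

lemma spec_testClause {b t : ℕ} {e : Expr} {p : Prog} {Q : Store → Prop} {j : Fin m}
    (hs : HasInput F C s) (hσ : Holds s 0 σ) (he : e.eval s = j)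
    (hp : ∀ s', Frame Reg.clause s s' → s'.mem = s.mem → s'.reg Reg.clause = j →
      s'.reg Reg.flag = (if (F j).Satisfied σ then 0 else 1) → Spec b p s' ω t 0 Q)
    (hb : b ≤ Reg.clause := by decide) :
    Spec b (testClause e p) s ω (5 * n + 8 + t) 0 Q := by
  have hf : Frame Reg.clause s (s.setReg Reg.clause j) := .setReg le_rfl
  refine Spec.mono (t := 5 * n + 5 + t + 1 + 2) (b := b) (d := 0 + 0) (spec_set_seq ?_ hb) le_rfl
  rw [he]
  exact spec_seq (spec_evalClause (hs.frame hf) hσ (setReg_reg_self _ _ _))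
    (fun s' hf' ⟨hmem, hflag⟩ => hp s' (hf.trans hf'.mono) hmem
      ((hf'.reg Reg.clause).trans (setReg_reg_self _ _ _)) hflag)
    (hb.trans (by decide)) le_rfl

/-- An optional clause is coded by its index plus one, or zero. -/
def code : Option (Fin m) → ℕ
  | none => 0
  | some j => j + 1

/-- Set `Reg.found` to the code of the selected core clause. -/
def findViolated : Prog :=
  .seq (.set Reg.found (.const 0)) (forLoop Reg.clauseIndex Reg.coreSize
    (testClause (coreClause (.reg Reg.clauseIndex))
      (.ite (.reg Reg.flag) (.set Reg.found (.add (.reg Reg.clause) (.const 1))) .skip)))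

lemma spec_findViolated (hs : HasInput F C s) (hσ : Holds s 0 σ) :
    Spec Reg.clauseIndex findViolated s ω (C.card * (5 * n + 13) + 5) 0 fun s' =>
      s'.mem = s.mem ∧ s'.reg Reg.found = code (selected F C σ) := by
  set l := C.sort (· ≤ ·)
  have hlen : l.length = C.card := Finset.length_sort _
  let I : ℕ → Store → Prop := fun i s' =>
    s'.mem = s.mem ∧ s'.reg Reg.found = code (lastViolated F (l.take i) σ)
  have hf : Frame Reg.clauseIndex s (s.setReg Reg.found 0) := .setReg (by decide)
  refine Spec.mono (b := Reg.clauseIndex) (t := C.card * (5 * n + 13) + 3 + 2)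
    (d := 0 * C.card) (spec_set_seq (Spec.imp (Q := I C.card) (spec_forLoop ?_
      (fun i s' v h => ⟨h.1, (setReg_reg_of_ne (by decide)).trans h.2⟩)
      ⟨rfl, setReg_reg_self _ _ _⟩ (hs.frame hf).reg_coreSize) fun s' _ h => ⟨h.1, ?_⟩))
  · rintro i hi s₁ hf₁ hidx ⟨hmem, hfound⟩
    have hil : i < l.length := hlen.symm ▸ hi
    have hs₁ := hs.frame (hf.trans hf₁)
    have htake : lastViolated F (l.take (i + 1)) σ =
        if (F l[i]).Satisfied σ then lastViolated F (l.take i) σ else some l[i] := by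
      rw [← List.take_concat_get' l i hil, lastViolated_concat]
    refine spec_testClause (b := Reg.found) (t := 2) hs₁ ((block_congr hmem).trans hσ)
      (eval_coreClause (i := .reg Reg.clauseIndex) hs₁ hil hidx)
      fun s₂ hf₂ hmem₂ hclause hflag => ?_
    refine spec_ite (t := 1) (fun h => spec_set ⟨hmem₂.trans hmem, ?_⟩)
      fun h => spec_skip ⟨hmem₂.trans hmem, ?_⟩
    · have hsat : ¬(F l[i]).Satisfied σ := fun hsat => h (hflag.trans (if_pos hsat))
      rw [htake, if_neg hsat, setReg_reg_self, Expr.eval, Expr.eval, Expr.eval, hclause, code]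
    · have hsat : (F l[i]).Satisfied σ := by
        by_contra hsat
        exact one_ne_zero ((hflag.trans (if_neg hsat)).symm.trans h)
      rw [htake, if_pos hsat, hf₂.reg Reg.found, hfound]
  · rw [h.2, ← hlen, List.take_length, selected]

/-- The number of clauses that `σ` violates. -/
def violated (F : Formula n m k) (σ : Fin n → Bool) : ℕ :=
  ∑ j, if (F j).Satisfied σ then 0 else 1

/-- Set `Reg.count` to the number of violated clauses. -/
def countViolated : Prog :=
  .seq (.set Reg.count (.const 0)) (forLoop Reg.clauseIndex Reg.m
    (testClause (.reg Reg.clauseIndex)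
      (.set Reg.count (.add (.reg Reg.count) (.reg Reg.flag)))))

lemma spec_countViolated (hs : HasInput F C s) (hσ : Holds s 0 σ) :
    Spec Reg.clauseIndex countViolated s ω (m * (5 * n + 12) + 5) 0 fun s' =>
      s'.mem = s.mem ∧ s'.reg Reg.count = violated F σ := by
  let violation : ℕ → ℕ := fun i =>
    if h : i < m then if (F ⟨i, h⟩).Satisfied σ then 0 else 1 else 0
  let I : ℕ → Store → Prop := fun i s' =>
    s'.mem = s.mem ∧ s'.reg Reg.count = ∑ x ∈ Finset.range i, violation x
  have hf : Frame Reg.clauseIndex s (s.setReg Reg.count 0) := .setReg (by decide)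
  refine Spec.mono (b := Reg.clauseIndex) (t := m * (5 * n + 12) + 3 + 2)
    (d := 0 * m) (spec_set_seq (Spec.imp (Q := I m) (spec_forLoop ?_
      (fun i s' v h => ⟨h.1, (setReg_reg_of_ne (by decide)).trans h.2⟩)
      ⟨rfl, setReg_reg_self _ _ _⟩ (hs.frame hf).reg_m) fun s' _ h => ⟨h.1, ?_⟩))
  · rintro i hi s₁ hf₁ hidx ⟨hmem, hcount⟩
    refine spec_testClause (j := ⟨i, hi⟩) (e := .reg Reg.clauseIndex) (b := Reg.found)
      (hs.frame (hf.trans hf₁)) ((block_congr hmem).trans hσ) hidx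
      fun s₂ hf₂ hmem₂ _ hflag => spec_set ⟨hmem₂.trans hmem, ?_⟩
    have hi' : violation i = if (F ⟨i, hi⟩).Satisfied σ then 0 else 1 := dif_pos hi
    rw [setReg_reg_self, Expr.eval, Expr.eval, Expr.eval, hf₂.reg Reg.count, hcount, hflag,
      Finset.sum_range_succ, hi']
  · rw [h.2, violated, Finset.sum_fin_eq_sum_range]

end Search

end RandRAM

/-- The state after a random assignment and `N` resampling steps of the core `C`. -/
noncomputable def coreTrial {n m k N : ℕ} (F : Formula n m k) (C : Finset (Fin m))
    (ω : Fin (N + 1) → Fin n → Bool) : Fin n → Bool :=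
  MoserTardos.trial (fun j => (F j).falsifier) (selected F C) ω

namespace RandRAM

/-- The first `N` rows of `n` coins each. -/
def rows (n N : ℕ) (ω : ℕ → Bool) : Fin N → Fin n → Bool := fun i x => drop (n * i) ω x

lemma tail_rows (n N : ℕ) (ω : ℕ → Bool) : Fin.tail (rows n (N + 1) ω) = rows n N (drop n ω) := by
  funext i x
  rw [Fin.tail, rows, rows, drop_drop, Fin.val_succ, Nat.mul_succ, add_comm]

lemma process_rows_succ {n : ℕ} {ι : Type*} (β : ι → PartialAssignment (Fin n))
    (sel : (Fin n → Bool) → Option ι) (σ : Fin n → Bool) (N : ℕ) (ω : ℕ → Bool) :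
    MoserTardos.process β sel σ (rows n (N + 1) ω) = MoserTardos.resampleStep β sel
      (MoserTardos.process β sel σ (rows n N ω)) fun x => drop (n * N) ω x := by
  rw [MoserTardos.process, List.ofFn_succ', List.concat_eq_append, List.foldl_concat]
  rfl

section Trial

variable {n m k N : ℕ} {F : Formula n m k} {C : Finset (Fin m)} {s : Store} {ω : ℕ → Bool}
  {σ ρ : Fin n → Bool}

/-- Copy the fresh coins to the variables of the clause with code `Reg.found`. -/
def copyClause : Prog :=
  let x := literalVar (.sub (.reg Reg.found) (.const 1)) (.reg Reg.index)
  forLoop Reg.index Reg.k (setCell 0 x (cell 1 x))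

lemma spec_copyClause {j : Fin m} (hs : HasInput F C s) (hj : s.reg Reg.found = j + 1)
    (hσ : Holds s 0 σ) (hρ : Holds s 1 ρ) :
    Spec Reg.index copyClause s ω (4 * n + 3) 0 fun s' =>
      Holds s' 0 ((F j).falsifier.resample σ ρ) ∧ ∀ b ≠ 0, s'.block n b = s.block n b := by
  let I : ℕ → Store → Prop := fun i s' =>
    (∀ v, s'.block n 0 v =
      (if ∃ a : Fin k, (a : ℕ) < i ∧ (F j).var a = v then ρ v else σ v).toNat) ∧
    ∀ b ≠ 0, s'.block n b = s.block n b
  have hk := Nat.mul_le_mul_right 4 (width_le F j)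
  refine Spec.mono (b := Reg.index) (t := k * (1 + 3) + 3) (d := 0 * k) (Spec.imp (Q := I k)
    (spec_forLoop ?_ (fun _ _ _ h => h) ⟨fun v => ?_, fun _ _ => rfl⟩ hs.reg_k)
    fun s' _ h => ⟨funext fun v => ?_, h.2⟩)
  · rintro i hi s₁ hf hidx ⟨hblock, hother⟩
    have hs₁ := hs.frame hf
    have hvar := eval_literalVar hs₁ (j := .sub (.reg Reg.found) (.const 1)) (a := .reg Reg.index)
      (c := j) (l := ⟨i, hi⟩) (by simp only [Expr.eval, hf.reg Reg.found, hj]; rfl) hidx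
    refine spec_setCell hs₁.reg_n hvar ⟨fun v => ?_, fun b hb => ?_⟩
    · rw [eval_cell hs₁.reg_n hvar, hother 1 one_ne_zero, hρ, block_setMem_self]
      rcases eq_or_ne v ((F j).var ⟨i, hi⟩) with rfl | hv
      · rw [Function.update_self, if_pos ⟨⟨i, hi⟩, Nat.lt_succ_self i, rfl⟩]
      · rw [Function.update_of_ne hv, hblock]
        simp only [exists_fin_lt_succ hi, hv.symm, or_false]
    · rw [block_setMem_of_ne _ _ _ hb, hother b hb]
  · simp [show s.block n 0 v = _ from congrFun hσ v]
  · rw [h.1, PartialAssignment.resample]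
    refine congrArg Bool.toNat (if_congr ?_ rfl rfl)
    rw [Clause.isSome_falsifier]
    exact ⟨fun ⟨a, _, ha⟩ => ⟨a, ha⟩, fun ⟨a, ha⟩ => ⟨a, a.2, ha⟩⟩

/-- One resampling step. It flips `n` coins even if no clause of the core is violated. -/
def stepProg : Prog :=
  .seq findViolated (.seq (flipBlock 1) (.ite (.reg Reg.found) copyClause .skip))

lemma spec_stepProg (hs : HasInput F C s) (hσ : Holds s 0 σ) :
    Spec Reg.clauseIndex stepProg s ω (C.card * (5 * n + 13) + 10 * n + 14) n fun s' =>
      Holds s' 0 (MoserTardos.resampleStep (fun j => (F j).falsifier) (selected F C) σ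
        fun v => ω v) ∧ s'.block n 2 = s.block n 2 := by
  refine Spec.mono (b := Reg.clauseIndex) (d := 0 + (n + 0))
    (t := C.card * (5 * n + 13) + 5 + (6 * n + 3 + (4 * n + 3 + 1) + 1) + 1)
    (spec_seq (b₂ := Reg.index) (spec_findViolated hs hσ) fun s₁ hf₁ ⟨hmem, hfound⟩ =>
      spec_seq (b₂ := Reg.index) (spec_flipBlock (hs.frame hf₁)) fun s₂ hf₂ ⟨hcoins, hother⟩ => ?_)
  have hfound₂ : s₂.reg Reg.found = code (selected F C σ) := (hf₂.reg Reg.found).trans hfound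
  have hσ₂ : Holds s₂ 0 σ := (hother 0 zero_ne_one).trans ((block_congr hmem).trans hσ)
  have hbest : s₂.block n 2 = s.block n 2 := (hother 2 (by decide)).trans (block_congr hmem)
  have hs₂ := (hs.frame hf₁).frame hf₂
  cases hsel : selected F C σ with
  | none =>
    rw [hsel] at hfound₂
    refine spec_ite (fun h => absurd hfound₂ h) fun _ => Spec.mono (b := Reg.index)
      (spec_skip ⟨?_, hbest⟩)
    rwa [MoserTardos.resampleStep, hsel]
  | some j =>
    rw [hsel] at hfound₂
    refine spec_ite (fun _ => Spec.imp (spec_copyClause hs₂ hfound₂ hσ₂ hcoins) fun s₃ _ h =>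
      ⟨?_, (h.2 2 two_ne_zero).trans hbest⟩) fun h => absurd (hfound₂.symm.trans h)
        (Nat.succ_ne_zero _)
    rw [MoserTardos.resampleStep, hsel]
    exact h.1

/-- A bound on the time of a trial with `N` resampling steps of `c` clauses on `n` variables. -/
def trialTime (n c N : ℕ) : ℕ := N * (c * (5 * n + 13) + 10 * n + 17) + 6 * n + 7

/-- A random assignment followed by `Reg.steps` resampling steps. -/
def trialProg : Prog := .seq (flipBlock 0) (forLoop Reg.round Reg.steps stepProg)

lemma spec_trialProg (hs : HasInput F C s) (hN : s.reg Reg.steps = N) :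
    Spec Reg.round trialProg s ω (trialTime n C.card N) (n * (N + 1)) fun s' =>
      Holds s' 0 (coreTrial F C (rows n (N + 1) ω)) ∧ s'.block n 2 = s.block n 2 := by
  let I : ℕ → Store → Prop := fun j s' =>
    Holds s' 0 (MoserTardos.process (fun j => (F j).falsifier) (selected F C) (fun v : Fin n => ω v)
      (rows n j (drop n ω))) ∧ s'.block n 2 = s.block n 2
  refine Spec.mono (b := Reg.round) (d := n + n * N)
    (t := 6 * n + 3 + (N * (C.card * (5 * n + 13) + 10 * n + 17) + 3) + 1)
    (spec_seq (spec_flipBlock hs) fun s₁ hf₁ ⟨hcoins, hother⟩ =>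
      Spec.imp (Q := I N) (spec_forLoop ?_ (fun _ _ _ h => h) ⟨hcoins, hother 2 two_ne_zero⟩
        ((hf₁.reg Reg.steps).trans hN)) fun s' _ h => ⟨?_, h.2⟩)
    le_rfl (by rw [trialTime]; omega) (by ring)
  · rintro j - s₂ hf₂ - ⟨hσ, hbest⟩
    refine (Spec.imp (spec_stepProg ((hs.frame hf₁).frame hf₂) hσ) fun s₃ _ h => ⟨?_, ?_⟩).mono
    · rw [process_rows_succ]
      exact h.1
    · exact h.2.trans hbest
  · rw [coreTrial, MoserTardos.trial, tail_rows]
    exact h.1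

end Trial

section Power

variable {s : Store} {ω : ℕ → Bool} {x y A : ℕ}

/-- Multiply `Reg.steps` by `Reg.base`. -/
def mulProg : Prog :=
  .seq (.set Reg.product (.const 0))
    (.seq (forLoop Reg.index Reg.base (.set Reg.product (.add (.reg Reg.product) (.reg Reg.steps))))
      (.set Reg.steps (.reg Reg.product)))

lemma spec_mulProg (hx : s.reg Reg.base = x) (hy : s.reg Reg.steps = y) :
    Spec Reg.steps mulProg s ω (4 * x + 7) 0 fun s' =>
      s'.mem = s.mem ∧ s'.reg Reg.steps = x * y := by
  have hloop : Spec Reg.index (forLoop Reg.index Reg.base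
      (.set Reg.product (.add (.reg Reg.product) (.reg Reg.steps)))) (s.setReg Reg.product 0) ω
      (x * (1 + 3) + 3) (0 * x) fun s' => s'.mem = s.mem ∧ s'.reg Reg.product = x * y := by
    refine spec_forLoop (I := fun i s' => s'.mem = s.mem ∧ s'.reg Reg.product = i * y)
      (fun i _ s' hf _ h => spec_set ⟨h.1, ?_⟩) (fun _ _ _ h => h)
      ⟨rfl, (setReg_reg_self _ _ _).trans (zero_mul y).symm⟩ hx
    have hs' : s'.reg Reg.steps = y := (hf.reg Reg.steps).trans hy
    simp only [setReg_reg_self, Expr.eval, h.2, hs', Nat.succ_mul]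
  exact Spec.mono (b := Reg.steps) (t := x * (1 + 3) + 3 + 1 + 1 + 2) (d := 0 * x + 0)
    (spec_set_seq (spec_seq (b₂ := Reg.steps) (t₁ := x * (1 + 3) + 3) hloop
      fun _ _ h => spec_set h))

/-- Multiply `Reg.steps` by the `e`-th power of `Reg.base`. -/
def powProg : ℕ → Prog
  | 0 => .skip
  | e + 1 => .seq (powProg e) mulProg

lemma spec_powProg (e : ℕ) (hx : s.reg Reg.base = x) (hA : s.reg Reg.steps = A) :
    Spec Reg.steps (powProg e) s ω (e * (4 * x + 8) + 1) 0 fun s' =>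
      s'.mem = s.mem ∧ s'.reg Reg.steps = A * x ^ e := by
  induction e with
  | zero => exact Spec.mono (b := Reg.steps) (spec_skip ⟨rfl, by rw [hA, pow_zero, mul_one]⟩)
  | succ e ih =>
    refine Spec.mono (b := Reg.steps) (spec_seq (b₂ := Reg.steps) ih fun s₁ hf ⟨hmem, hsteps⟩ =>
      Spec.imp (spec_mulProg ((hf.reg Reg.base).trans hx) hsteps) fun s₂ _ h =>
        ⟨h.1.trans hmem, h.2.trans ?_⟩) (ht := by ring_nf; omega)
    rw [pow_succ, mul_left_comm, mul_comm x]

/-- Set `Reg.steps` to `A * x ^ e`. -/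
def computeSteps (x : Expr) (A e : ℕ) : Prog :=
  .seq (.set Reg.base x) (.seq (.set Reg.steps (.const A)) (powProg e))

lemma spec_computeSteps (x : Expr) (A e : ℕ) :
    Spec Reg.base (computeSteps x A e) s ω (e * (4 * x.eval s + 8) + 5) 0 fun s' =>
      s'.mem = s.mem ∧ s'.reg Reg.steps = A * x.eval s ^ e :=
  spec_set_seq (spec_set_seq (Spec.mono (spec_powProg e (setReg_reg_of_ne (by decide))
    (setReg_reg_self _ _ _))))

end Power

section Programs

variable {n m k N : ℕ} {F : Formula n m k} {C : Finset (Fin m)} {s : Store} {ω : ℕ → Bool}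
  {σ : Fin n → Bool}

lemma hasInput_input : HasInput F C (input F C) := .refl _ _

/-- One trial with `(n + |C| + 1) ^ e` resampling steps. -/
def singleProg (e : ℕ) : Prog :=
  .seq (computeSteps (.add (.add (.reg Reg.n) (.reg Reg.coreSize)) (.const 1)) 1 e) trialProg

/-- A bound on the time of `singleProg e` for `n` variables and `c` core clauses. -/
def singleTime (e n c : ℕ) : ℕ :=
  e * (4 * (n + c + 1) + 8) + 6 + trialTime n c ((n + c + 1) ^ e)

lemma spec_singleProg (e : ℕ) (hN : N = (n + C.card + 1) ^ e) :
    Spec Reg.base (singleProg e) (input F C) ω (singleTime e n C.card) (n * (N + 1)) fun s' =>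
      Holds s' 0 (coreTrial F C (rows n (N + 1) ω)) := by
  refine Spec.mono (b := Reg.base) (d := 0 + n * (N + 1)) (spec_seq (b₂ := Reg.round)
    (spec_computeSteps _ 1 e) fun s₁ hf ⟨_, hsteps⟩ => Spec.imp (spec_trialProg (N := N)
      (hasInput_input.frame hf) ((hsteps.trans (one_mul _)).trans hN.symm)) fun _ _ h => h.1)
    (ht := ?_)
  rw [singleTime, ← hN]
  change e * (4 * (n + C.card + 1) + 8) + 5 + trialTime n C.card N + 1 ≤ _
  omega

/-- If the assignment in block `0` violates fewer than `Reg.best` clauses, copy it to block `2`. -/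
def recordBest : Prog :=
  .seq countViolated (.ite (.lt (.reg Reg.count) (.reg Reg.best))
    (.seq (.set Reg.best (.reg Reg.count)) (copyBlock 0 2)) .skip)

/-- If the assignment in block `0` satisfies the core, compare it with the best one so far. -/
def keepBest : Prog := .seq findViolated (.ite (.reg Reg.found) .skip recordBest)

/-- Unless `Reg.best` exceeds the number of clauses, it bounds the number of clauses violated by
the assignment in block `2`, which then satisfies the core. -/
def Kept (F : Formula n m k) (C : Finset (Fin m)) (s : Store) : Prop :=
  ∃ τ : Fin n → Bool, Holds s 2 τ ∧
    (s.reg Reg.best ≤ m → selected F C τ = none ∧ violated F τ ≤ s.reg Reg.best)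

lemma spec_recordBest (hs : HasInput F C s) (hσ : Holds s 0 σ) (hsel : selected F C σ = none)
    (hK : Kept F C s) :
    Spec Reg.best recordBest s ω (m * (5 * n + 12) + 6 * n + 13) 0 fun s' =>
      Kept F C s' ∧ s'.reg Reg.best ≤ s.reg Reg.best ∧ s'.reg Reg.best ≤ violated F σ := by
  obtain ⟨τ, hτ, hτbest⟩ := hK
  refine Spec.mono (b := Reg.best) (d := 0 + 0)
    (t := m * (5 * n + 12) + 5 + (6 * n + 3 + 2 + 1) + 1)
    (spec_seq (b₂ := Reg.best) (spec_countViolated hs hσ) fun s₁ hf₁ ⟨hmem, hcount⟩ => ?_)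
  have hbest : s₁.reg Reg.best = s.reg Reg.best := hf₁.reg Reg.best
  have hguard : (Expr.lt (.reg Reg.count) (.reg Reg.best)).eval s₁ =
      if violated F σ < s.reg Reg.best then 1 else 0 := by
    simp only [Expr.eval, hcount, hbest]
  refine spec_ite (fun hne => ?_) fun heq => ?_
  · have hlt : violated F σ < s.reg Reg.best := by
      by_contra h
      exact hne (hguard.trans (if_neg h))
    refine spec_set_seq (Spec.mono (Spec.imp (spec_copyBlock (src := 0) (dst := 2)
      ((hs.frame hf₁).frame (.setReg le_rfl)) (by decide)) fun s₂ hf₂ h => ?_))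
    have hbest₂ : s₂.reg Reg.best = violated F σ :=
      (hf₂.reg Reg.best).trans ((setReg_reg_self _ _ _).trans hcount)
    exact ⟨⟨σ, h.1.trans ((block_congr hmem).trans hσ), fun _ => ⟨hsel, hbest₂.ge⟩⟩,
      hbest₂.trans_le hlt.le, hbest₂.le⟩
  · have hle : s.reg Reg.best ≤ violated F σ := by
      by_contra h
      exact one_ne_zero ((hguard.trans (if_pos (not_le.1 h))).symm.trans heq)
    exact Spec.mono (b := Reg.best) (spec_skip ⟨⟨τ, (block_congr hmem).trans hτ, by rwa [hbest]⟩,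
      hbest.le, hbest.trans_le hle⟩)

lemma spec_keepBest (hs : HasInput F C s) (hσ : Holds s 0 σ) (hK : Kept F C s) :
    Spec Reg.best keepBest s ω (C.card * (5 * n + 13) + m * (5 * n + 12) + 6 * n + 20) 0 fun s' =>
      Kept F C s' ∧ s'.reg Reg.best ≤ s.reg Reg.best ∧
        (selected F C σ = none → s'.reg Reg.best ≤ violated F σ) := by
  refine Spec.mono (b := Reg.best) (d := 0 + 0)
    (t := C.card * (5 * n + 13) + 5 + (m * (5 * n + 12) + 6 * n + 13 + 1) + 1)
    (spec_seq (b₂ := Reg.best) (spec_findViolated hs hσ) fun s₁ hf ⟨hmem, hfound⟩ => ?_)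
  have hbest : s₁.reg Reg.best = s.reg Reg.best := hf.reg Reg.best
  have hK₁ : Kept F C s₁ := by
    obtain ⟨τ, hτ, hτbest⟩ := hK
    exact ⟨τ, (block_congr hmem).trans hτ, by rwa [hbest]⟩
  rw [← hbest]
  refine spec_ite (fun hne => ?_) fun heq => ?_
  · have hsel : selected F C σ ≠ none := fun h => hne (hfound.trans (by rw [h, code]))
    exact Spec.mono (b := Reg.best) (spec_skip ⟨hK₁, le_rfl, fun h => absurd h hsel⟩)
  · have hsel : selected F C σ = none := by
      cases h : selected F C σ with
      | none => rfl
      | some j => exact absurd (heq.symm.trans hfound) (by rw [h]; exact (Nat.succ_ne_zero _).symm)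
    exact Spec.imp (spec_recordBest (hs.frame hf) ((block_congr hmem).trans hσ) hsel hK₁)
      fun _ _ h => ⟨h.1, h.2.1, fun _ => h.2.2⟩

/-- One trial, whose result is kept if it is the best one so far. -/
def attemptProg : Prog := .seq trialProg keepBest

/-- A bound on the time of one attempt with `N` resampling steps, for `n` variables, `m` clauses,
`c` core clauses. -/
def attemptTime (n m c N : ℕ) : ℕ :=
  trialTime n c N + c * (5 * n + 13) + m * (5 * n + 12) + 6 * n + 21

lemma spec_attemptProg (hs : HasInput F C s) (hN : s.reg Reg.steps = N) (hK : Kept F C s) :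
    Spec Reg.best attemptProg s ω (attemptTime n m C.card N) (n * (N + 1)) fun s' =>
      Kept F C s' ∧ s'.reg Reg.best ≤ s.reg Reg.best ∧
        (selected F C (coreTrial F C (rows n (N + 1) ω)) = none →
          s'.reg Reg.best ≤ violated F (coreTrial F C (rows n (N + 1) ω))) := by
  refine Spec.mono (b := Reg.best) (t := trialTime n C.card N +
      (C.card * (5 * n + 13) + m * (5 * n + 12) + 6 * n + 20) + 1) (d := n * (N + 1) + 0)
    (spec_seq (b₂ := Reg.best) (spec_trialProg hs hN) fun s₁ hf ⟨hσ, hother⟩ => ?_)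
    (ht := by rw [attemptTime]; omega)
  have hbest : s₁.reg Reg.best = s.reg Reg.best := hf.reg Reg.best
  obtain ⟨τ, hτ, hτbest⟩ := hK
  rw [← hbest]
  exact spec_keepBest (hs.frame hf) hσ ⟨τ, hother.trans hτ, by rwa [hbest]⟩

/-- The best of `A * (n + m + 1) ^ e` trials with as many resampling steps each. -/
def bestProg (A e : ℕ) : Prog :=
  .seq (computeSteps (.add (.add (.reg Reg.n) (.reg Reg.m)) (.const 1)) A e)
    (.seq (.set Reg.best (.add (.reg Reg.m) (.const 1)))
      (.seq (forLoop Reg.attempt Reg.steps attemptProg) (copyBlock 2 0)))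

/-- A bound on the time of `bestProg A e` for `n` variables, `m` clauses, `c` core clauses. -/
def bestTime (A e n m c : ℕ) : ℕ :=
  e * (4 * (n + m + 1) + 8) + 6 * n + 15 +
    A * (n + m + 1) ^ e * (attemptTime n m c (A * (n + m + 1) ^ e) + 3)

lemma violated_le (σ : Fin n → Bool) : violated F σ ≤ m := by
  rw [violated]
  calc _ ≤ ∑ _j : Fin m, 1 := Finset.sum_le_sum fun j _ => by split_ifs <;> omega
    _ = m := by simp

/-- The `r`-th of the consecutive trials with `N` resampling steps. -/
noncomputable def nthTrial (F : Formula n m k) (C : Finset (Fin m)) (N : ℕ) (ω : ℕ → Bool) (r : ℕ) :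
    Fin n → Bool :=
  coreTrial F C (rows n (N + 1) (drop (n * (N + 1) * r) ω))

lemma spec_attempts (hs : HasInput F C s) (hN : s.reg Reg.steps = N)
    (hbest : s.reg Reg.best = m + 1) (hblock : Holds (n := n) s 2 fun _ => false) :
    Spec Reg.attempt (forLoop Reg.attempt Reg.steps attemptProg) s ω
      (N * (attemptTime n m C.card N + 3) + 3) (n * (N + 1) * N) fun s' =>
      ∃ τ : Fin n → Bool, Holds s' 2 τ ∧ ∀ r < N, selected F C (nthTrial F C N ω r) = none →
        selected F C τ = none ∧ violated F τ ≤ violated F (nthTrial F C N ω r) := by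
  let I : ℕ → Store → Prop := fun j s' => Kept F C s' ∧
    ∀ r < j, selected F C (nthTrial F C N ω r) = none →
      s'.reg Reg.best ≤ violated F (nthTrial F C N ω r)
  refine Spec.imp (Q := I N) (spec_forLoop (fun j _ s₁ hf _ h => Spec.imp
    (spec_attemptProg (hs.frame hf) ((hf.reg Reg.steps).trans hN) h.1) fun s₂ _ h₂ =>
      ⟨h₂.1, fun r hr hsel => ?_⟩) (fun _ _ _ h => h)
    ⟨⟨fun _ => false, hblock, fun h => absurd (hbest.symm.trans_le h) m.lt_irrefl⟩,
      fun r hr => absurd hr r.not_lt_zero⟩ hN) ?_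
  · rcases Nat.lt_succ_iff_lt_or_eq.1 hr with hr | rfl
    · exact h₂.2.1.trans (h.2 r hr hsel)
    · exact h₂.2.2 hsel
  · rintro s₁ - ⟨⟨τ, hτ, hτbest⟩, hle⟩
    refine ⟨τ, hτ, fun r hr hsel => ?_⟩
    obtain ⟨hsat, hviolated⟩ := hτbest ((hle r hr hsel).trans (violated_le _))
    exact ⟨hsat, hviolated.trans (hle r hr hsel)⟩

lemma spec_bestProg (A e : ℕ) (hN : N = A * (n + m + 1) ^ e) :
    Spec Reg.base (bestProg A e) (input F C) ω (bestTime A e n m C.card) (n * (N + 1) * N)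
      fun s' => ∃ τ : Fin n → Bool, Holds s' 0 τ ∧ ∀ r < N,
        selected F C (nthTrial F C N ω r) = none →
          selected F C τ = none ∧ violated F τ ≤ violated F (nthTrial F C N ω r) := by
  refine Spec.mono (b := Reg.base) (d := 0 + (n * (N + 1) * N + 0))
    (t := e * (4 * (n + m + 1) + 8) + 5 +
      (N * (attemptTime n m C.card N + 3) + 3 + (6 * n + 3) + 1 + 2) + 1)
    (spec_seq (b₂ := Reg.base) (t₁ := e * (4 * (n + m + 1) + 8) + 5) (spec_computeSteps _ A e)
      fun s₁ hf₁ ⟨hmem, hsteps⟩ => spec_set_seq ?_) (ht := by rw [bestTime, ← hN]; omega)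
  have hs₁ : HasInput F C s₁ := hasInput_input.frame hf₁
  have hs : HasInput F C (s₁.setReg Reg.best ((Expr.add (.reg Reg.m) (.const 1)).eval s₁)) :=
    hs₁.frame (.setReg le_rfl)
  refine spec_seq (b₂ := Reg.index) (t₁ := N * (attemptTime n m C.card N + 3) + 3)
    (spec_attempts hs (hsteps.trans hN.symm) ?_ ?_) fun s₂ hf₂ ⟨τ, hτ, hτbest⟩ => Spec.imp
      (spec_copyBlock (hs.frame hf₂) (by decide)) fun s₃ _ h => ⟨τ, h.1.trans hτ, hτbest⟩
  · simp only [setReg_reg_self, Expr.eval, hs₁.reg_m]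
  · exact block_congr hmem

lemma Holds.assignment_eq (h : Holds s 0 σ) : s.assignment n = σ := by
  funext v
  have hv : s.mem 0 (0 * n + v) = (σ v).toNat := congrFun h v
  rw [zero_mul, zero_add] at hv
  rw [Store.assignment, hv]
  cases σ v <;> rfl

end Programs

end RandRAM

section Repetition

lemma expect_indicator_forall_mem {ι α : Type*} [Fintype ι] [DecidableEq ι] [Fintype α]
    (S : Set α) :
    𝔼 y : ι → α, {y | ∀ r, y r ∈ S}.indicator (1 : (ι → α) → ℝ) y =
      (𝔼 x, S.indicator (1 : α → ℝ) x) ^ Fintype.card ι := by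
  have hprod : ∀ y : ι → α, {y | ∀ r, y r ∈ S}.indicator (1 : (ι → α) → ℝ) y =
      ∏ r, S.indicator (1 : α → ℝ) (y r) := fun y => by
    classical
    simp only [Set.indicator_apply, Pi.one_apply, Finset.prod_boole, Finset.mem_univ, true_imp_iff]
    rfl
  simp_rw [hprod]
  rw [expect_prod_pi, Finset.prod_const, Finset.card_univ]

lemma expect_indicator_lt_mul_le {α : Type*} [Fintype α] {X : α → ℝ} {μ a : ℝ}
    (hX : ∀ x, 0 ≤ X x) (hμ : 𝔼 x, X x ≤ μ) (ha : 0 < a) :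
    𝔼 x, {x | a * μ < X x}.indicator (1 : α → ℝ) x ≤ 1 / a := by
  have hle : ∀ x, a * μ * {x | a * μ < X x}.indicator (1 : α → ℝ) x ≤ X x := fun x => by
    by_cases hx : a * μ < X x
    · simpa [hx] using hx.le
    · simpa [hx] using hX x
  rcases (Finset.expect_nonneg fun x _ => hX x).trans hμ |>.eq_or_lt with rfl | hμ0
  · have hX0 : X = 0 := (Fintype.expect_eq_zero_iff_of_nonneg hX).1
      (hμ.antisymm (Finset.expect_nonneg fun x _ => hX x))
    simp [hX0, ha.le]
  · rw [le_div_iff₀ ha, ← mul_le_mul_iff_right₀ hμ0]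
    calc μ * ((𝔼 x, {x | a * μ < X x}.indicator (1 : α → ℝ) x) * a)
        = 𝔼 x, a * μ * {x | a * μ < X x}.indicator (1 : α → ℝ) x := by
          rw [← Finset.mul_expect]; ring
      _ ≤ μ * 1 := (Finset.expect_le_expect fun x _ => hle x).trans (hμ.trans_eq (mul_one μ).symm)

namespace RandRAM

lemma coinMeasure_real_exists_rows_mem {n M : ℕ} (S : Set (Fin M → Fin n → Bool)) (R : ℕ) :
    coinMeasure.real {ω | ∃ r : Fin R, rows n M (drop (n * M * r) ω) ∈ S} =
      1 - (𝔼 x, Sᶜ.indicator (1 : (Fin M → Fin n → Bool) → ℝ) x) ^ R := by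
  let e : Fin R × Fin M × Fin n ↪ ℕ := (((Equiv.refl _).prodCongr finProdFinEquiv).trans
    finProdFinEquiv).toEmbedding.trans Fin.valEmbedding
  let curry := (Equiv.curry (Fin R) (Fin M × Fin n) Bool).trans
    (Equiv.piCongrRight fun _ => Equiv.curry (Fin M) (Fin n) Bool)
  have hrows : ∀ (ω : ℕ → Bool) (r : Fin R),
      rows n M (drop (n * M * r) ω) = curry (fun t => ω (e t)) r := fun ω r => by
    funext i x
    exact congrArg ω (by rw [mul_comm n M, add_assoc]; exact (add_assoc _ _ _).symm)
  have hset : {y : Fin R → Fin M → Fin n → Bool | ∃ r, y r ∈ S} =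
      {y | ∀ r, y r ∈ Sᶜ}ᶜ := by
    ext y
    simp
  calc coinMeasure.real {ω | ∃ r : Fin R, rows n M (drop (n * M * r) ω) ∈ S}
      = 𝔼 x, {x | ∃ r, curry x r ∈ S}.indicator 1 x := by
        simp_rw [hrows]
        exact coinMeasure_real_comp_mem e {x | ∃ r, curry x r ∈ S}
    _ = 𝔼 y, {y | ∃ r, y r ∈ S}.indicator 1 y := Fintype.expect_equiv curry _ _ fun _ => rfl
    _ = 1 - (𝔼 x, Sᶜ.indicator (1 : (Fin M → Fin n → Bool) → ℝ) x) ^ R := by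
        rw [hset, expect_indicator_compl, expect_indicator_forall_mem, Fintype.card_fin]

end RandRAM

end Repetition

section CoreTrial

open MoserTardos

variable {n m k : ℕ} {F : Formula n m k} {C : Finset (Fin m)} {j : Fin m}

lemma nbhd_falsifier_subset :
    nbhd (fun i => (F i).falsifier) C {j} ⊆
      insert j (C.filter fun i => i ≠ j ∧ (F i).SharesVar (F j)) := by
  intro i hi
  obtain ⟨hiC, _, hj', hadj⟩ := mem_nbhd.1 hi
  rw [Finset.mem_singleton.1 hj', Adj, disjoint_comm, Clause.disjoint_support_falsifier,
    not_not] at hadj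
  by_cases hij : i = j
  · exact Finset.mem_insert.2 (.inl hij)
  · exact Finset.mem_insert_of_mem (Finset.mem_filter.2
      ⟨hiC, hij, hadj.resolve_left fun h => hij h.symm⟩)

lemma card_nbhd_falsifier_le :
    (nbhd (fun i => (F i).falsifier) C {j}).card ≤ F.coreDegree C j + 1 :=
  (Finset.card_le_card nbhd_falsifier_subset).trans (Finset.card_insert_le _ _)

lemma card_nbhd_falsifier_le_of_notMem (hj : j ∉ C) :
    (nbhd (fun i => (F i).falsifier) C {j}).card ≤ F.coreDegree C j :=
  Finset.card_le_card fun _ hi => (Finset.mem_insert.1 (nbhd_falsifier_subset hi)).resolve_left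
    fun hij => hj (hij ▸ nbhd_subset _ hi)

/-- The weight `e 2⁻ᵏ` of a clause of the core in the local lemma. -/
noncomputable def clauseWeight (k : ℕ) : ℝ := Real.exp 1 / 2 ^ k

lemma clauseWeight_pos (k : ℕ) : 0 < clauseWeight k := by
  unfold clauseWeight
  positivity

lemma clauseWeight_mul (k : ℕ) : clauseWeight k * (2 ^ k / Real.exp 1) = 1 := by
  unfold clauseWeight
  field_simp

lemma one_add_pow_le_exp {w a : ℝ} {N : ℕ} (hw : 0 ≤ w) (h : w * N ≤ a) :
    (1 + w) ^ N ≤ Real.exp a := by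
  calc (1 + w) ^ N ≤ Real.exp w ^ N := by
        gcongr
        rw [add_comm]
        exact Real.add_one_le_exp w
    _ = Real.exp (w * N) := by rw [← Real.exp_nat_mul, mul_comm]
    _ ≤ Real.exp a := Real.exp_le_exp.2 h

lemma localLemmaCondition_clauseWeight
    (hC : ∀ j ∈ C, (F.coreDegree C j : ℝ) ≤ 2 ^ k / Real.exp 1 - 1) :
    LocalLemmaCondition (fun i => (F i).falsifier) C fun _ => clauseWeight k where
  nonneg _ _ := (clauseWeight_pos k).le
  prob_mul_prod_le j hj := by
    have hcard : ((nbhd (fun i => (F i).falsifier) C {j}).card : ℝ) ≤ 2 ^ k / Real.exp 1 :=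
      calc ((nbhd (fun i => (F i).falsifier) C {j}).card : ℝ)
          ≤ (F.coreDegree C j : ℝ) + 1 := mod_cast card_nbhd_falsifier_le
        _ ≤ 2 ^ k / Real.exp 1 := by linarith [hC j hj]
    rw [Finset.prod_const, Clause.prob_falsifier]
    calc ((2 : ℝ) ^ k)⁻¹ * (1 + clauseWeight k) ^ (nbhd (fun i => (F i).falsifier) C {j}).card
        ≤ ((2 : ℝ) ^ k)⁻¹ * Real.exp 1 := by
          gcongr
          refine one_add_pow_le_exp (clauseWeight_pos k).le ?_
          rw [← clauseWeight_mul k]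
          exact mul_le_mul_of_nonneg_left hcard (clauseWeight_pos k).le
      _ = clauseWeight k := inv_mul_eq_div _ _

lemma expect_selected_coreTrial_le
    (hC : ∀ j ∈ C, (F.coreDegree C j : ℝ) ≤ 2 ^ k / Real.exp 1 - 1) {N : ℕ} (hN : 0 < N) :
    𝔼 x : Fin (N + 1) → Fin n → Bool,
      {σ | selected F C σ ≠ none}.indicator (1 : (Fin n → Bool) → ℝ) (coreTrial F C x) ≤
        C.card / N := by
  have hweight : ∀ j ∈ C, clauseWeight k ≤ 1 := fun j hj => by
    rw [← clauseWeight_mul k]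
    exact le_mul_of_one_le_right (clauseWeight_pos k).le
      (by linarith [hC j hj, (F.coreDegree C j).cast_nonneg (α := ℝ)])
  rw [le_div_iff₀' (by positivity)]
  calc _ ≤ ∑ _j ∈ C, clauseWeight k := expect_alive_trial_le
        (localLemmaCondition_clauseWeight hC) (isSound_selected F C) N
    _ ≤ ∑ _j ∈ C, 1 := Finset.sum_le_sum hweight
    _ = C.card := by simp

lemma expect_agrees_coreTrial_le {γ : ℝ} (hγ : 0 ≤ γ)
    (hC : ∀ j ∈ C, (F.coreDegree C j : ℝ) ≤ 2 ^ k / Real.exp 1 - 1) (hj : j ∉ C)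
    (hγj : (F.coreDegree C j : ℝ) ≤ γ * (2 ^ k / Real.exp 1 - 1)) (N : ℕ) :
    𝔼 x : Fin (N + 1) → Fin n → Bool,
      {σ | (F j).falsifier.Agrees σ}.indicator (1 : (Fin n → Bool) → ℝ) (coreTrial F C x) ≤
        ((2 : ℝ) ^ k)⁻¹ * Real.exp γ := by
  refine (expect_agrees_trial_le (localLemmaCondition_clauseWeight hC) (isSound_selected F C)
    j N).trans ?_
  rw [Finset.prod_const, Clause.prob_falsifier]
  gcongr
  refine one_add_pow_le_exp (clauseWeight_pos k).le ?_
  calc clauseWeight k * ((nbhd (fun i => (F i).falsifier) C {j}).card : ℝ)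
      ≤ clauseWeight k * (γ * (2 ^ k / Real.exp 1 - 1)) := by
        refine mul_le_mul_of_nonneg_left (le_trans ?_ hγj) (clauseWeight_pos k).le
        exact_mod_cast card_nbhd_falsifier_le_of_notMem hj
    _ = γ - clauseWeight k * γ := by linear_combination γ * clauseWeight_mul k
    _ ≤ γ := sub_le_self _ (mul_nonneg (clauseWeight_pos k).le hγ)

lemma expect_violatedOutside_coreTrial_le {γ : ℝ} (hγ : 0 ≤ γ)
    (hC : ∀ j ∈ C, (F.coreDegree C j : ℝ) ≤ 2 ^ k / Real.exp 1 - 1)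
    (hD : ∀ j ∉ C, (F.coreDegree C j : ℝ) ≤ γ * (2 ^ k / Real.exp 1 - 1)) (N : ℕ) :
    𝔼 x : Fin (N + 1) → Fin n → Bool, (F.violatedOutside C (coreTrial F C x) : ℝ) ≤
      ((2 : ℝ) ^ k)⁻¹ * Real.exp γ * Cᶜ.card := by
  have hsum : ∀ σ, (F.violatedOutside C σ : ℝ) =
      ∑ j ∈ Cᶜ, {σ | (F j).falsifier.Agrees σ}.indicator 1 σ := fun σ => by
    rw [Formula.violatedOutside, Finset.card_filter, Nat.cast_sum]
    refine Finset.sum_congr rfl fun j _ => ?_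
    simp only [Set.indicator_apply, Set.mem_ofPred_eq, Clause.agrees_falsifier, Pi.one_apply,
      Nat.cast_ite, Nat.cast_one, Nat.cast_zero]
  simp_rw [hsum]
  rw [Finset.expect_sum_comm, mul_comm _ (Cᶜ.card : ℝ), ← nsmul_eq_mul]
  exact Finset.sum_le_card_nsmul _ _ _ fun j hj => expect_agrees_coreTrial_le hγ hC
    (Finset.mem_compl.1 hj) (hD j (Finset.mem_compl.1 hj)) N

/-- The assignments that satisfy the core and violate at most `a` of the other clauses. -/
def Good (F : Formula n m k) (C : Finset (Fin m)) (a : ℝ) : Set (Fin n → Bool) :=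
  {σ | (∀ j ∈ C, (F j).Satisfied σ) ∧ (F.violatedOutside C σ : ℝ) ≤ a}

lemma indicator_compl_good_le (a : ℝ) (σ : Fin n → Bool) :
    (Good F C a)ᶜ.indicator (1 : (Fin n → Bool) → ℝ) σ ≤
      {σ | a < F.violatedOutside C σ}.indicator 1 σ +
        {σ | selected F C σ ≠ none}.indicator 1 σ := by
  have hsub : (Good F C a)ᶜ ⊆
      {σ | a < F.violatedOutside C σ} ∪ {σ | selected F C σ ≠ none} := fun τ hτ =>
    or_iff_not_imp_right.2 fun hsel =>
      not_le.1 fun hle => hτ ⟨(selected_eq_none F C).1 (not_not.1 hsel), hle⟩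
  refine (Set.indicator_le_indicator_of_subset hsub (fun _ => zero_le_one) σ).trans ?_
  rw [← Set.indicator_union_add_inter_apply]
  exact le_add_of_nonneg_right (Set.indicator_nonneg (fun _ _ => zero_le_one) σ)

lemma expect_compl_good_coreTrial_le {γ a : ℝ} (hγ : 0 ≤ γ) (ha : 0 < a)
    (hC : ∀ j ∈ C, (F.coreDegree C j : ℝ) ≤ 2 ^ k / Real.exp 1 - 1)
    (hD : ∀ j ∉ C, (F.coreDegree C j : ℝ) ≤ γ * (2 ^ k / Real.exp 1 - 1)) {N : ℕ} (hN : 0 < N) :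
    𝔼 x : Fin (N + 1) → Fin n → Bool,
      (Good F C (a * ((2 : ℝ) ^ k)⁻¹ * Real.exp γ * Cᶜ.card))ᶜ.indicator
        (1 : (Fin n → Bool) → ℝ) (coreTrial F C x) ≤ 1 / a + C.card / N := by
  rw [mul_assoc, mul_assoc, ← mul_assoc _ (Real.exp γ)]
  refine (Finset.expect_le_expect fun x _ => indicator_compl_good_le _ _).trans ?_
  rw [Finset.expect_add_distrib]
  exact add_le_add (expect_indicator_lt_mul_le (fun _ => Nat.cast_nonneg _)
    (expect_violatedOutside_coreTrial_le hγ hC hD N) ha) (expect_selected_coreTrial_le hC hN)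

end CoreTrial

namespace RandRAM

section Output

variable {n m k N T : ℕ} {F : Formula n m k} {C : Finset (Fin m)} {ω : ℕ → Bool} {a : ℝ}

lemma haltsWithin_of_spec {P : Prog} {s : Store} {b t d : ℕ} {Q : (ℕ → Bool) → Store → Prop}
    (h : ∀ ω, Spec b P s ω t d (Q ω)) (hT : t ≤ T) : HaltsWithin P s T := by
  intro ω
  obtain ⟨s', -, hrun⟩ := (h ω).run_eq
  rw [hrun T hT]

lemma output_of_spec {P : Prog} {b t d : ℕ} {Q : (Fin n → Bool) → Prop}
    (h : Spec b P (input F C) ω t d fun s' => ∃ τ, Holds s' 0 τ ∧ Q τ) (hT : t ≤ T) :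
    Q (output P F C T ω) := by
  obtain ⟨s', ⟨τ, hτ, hQ⟩, hrun⟩ := h.run_eq
  rwa [output, hrun T hT, hτ.assignment_eq]

lemma haltsWithin_singleProg {e : ℕ} (hT : singleTime e n C.card ≤ T) :
    HaltsWithin (singleProg e) (input F C) T :=
  haltsWithin_of_spec (fun _ => spec_singleProg e rfl) hT

lemma output_singleProg {e : ℕ} (hN : N = (n + C.card + 1) ^ e)
    (hT : singleTime e n C.card ≤ T) :
    output (singleProg e) F C T ω = coreTrial F C (rows n (N + 1) ω) :=
  output_of_spec (Q := (· = coreTrial F C (rows n (N + 1) ω)))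
    ((spec_singleProg e hN).imp fun _ _ h => ⟨_, h, rfl⟩) hT

lemma haltsWithin_bestProg {A e : ℕ} (hT : bestTime A e n m C.card ≤ T) :
    HaltsWithin (bestProg A e) (input F C) T :=
  haltsWithin_of_spec (fun _ => spec_bestProg A e rfl) hT

lemma violated_eq_violatedOutside {σ : Fin n → Bool} (h : ∀ j ∈ C, (F j).Satisfied σ) :
    violated F σ = F.violatedOutside C σ := by
  rw [violated, Formula.violatedOutside, ← Finset.sum_add_sum_compl C,
    Finset.sum_eq_zero fun j hj => if_pos (h j hj), zero_add, Finset.card_filter]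
  exact Finset.sum_congr rfl fun j _ => by rw [ite_not]

lemma output_bestProg_mem_good {A e r : ℕ} (hN : N = A * (n + m + 1) ^ e)
    (hT : bestTime A e n m C.card ≤ T) (hr : r < N) (hgood : nthTrial F C N ω r ∈ Good F C a) :
    output (bestProg A e) F C T ω ∈ Good F C a := by
  have hbest := output_of_spec (spec_bestProg (F := F) (C := C) (ω := ω) A e hN) hT
  obtain ⟨hsat, hle⟩ := hbest r hr ((selected_eq_none F C).2 hgood.1)
  rw [selected_eq_none] at hsat
  rw [violated_eq_violatedOutside hsat, violated_eq_violatedOutside hgood.1] at hle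
  exact ⟨hsat, (Nat.cast_le.2 hle).trans hgood.2⟩

end Output

section RunningTime

open Polynomial

lemma eval_add_one_mul_le (q : ℕ[X]) (x : ℕ) :
    (q.eval x + 1) * (x + 1) ≤ (q.eval 1 + 1) * (x + 1) ^ (q.natDegree + 1) := by
  have heval : q.eval x ≤ q.eval 1 * (x + 1) ^ q.natDegree := by
    rw [eval_eq_sum_range, eval_eq_sum_range, Finset.sum_mul]
    refine Finset.sum_le_sum fun i hi => ?_
    rw [one_pow, mul_one]
    exact Nat.mul_le_mul_left _ ((Nat.pow_le_pow_left (Nat.le_succ x) i).trans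
      (Nat.pow_le_pow_right (Nat.succ_pos x) (Finset.mem_range_succ_iff.1 hi)))
  rw [pow_succ, ← mul_assoc, add_mul (q.eval 1), one_mul]
  gcongr
  exact Nat.one_le_pow _ _ (Nat.succ_pos x)

lemma exists_polynomial_singleTime_le (e : ℕ) :
    ∃ p : ℕ[X], ∀ n c, singleTime e n c ≤ p.eval (n + c) := by
  refine ⟨C e * (4 * (X + 1) + 8) + 6 +
    ((X + 1) ^ e * (X * (5 * X + 13) + 10 * X + 17) + 6 * X + 7), fun n c => ?_⟩
  have hn : n ≤ n + c := Nat.le_add_right n c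
  have hc : c ≤ n + c := Nat.le_add_left c n
  simp only [singleTime, trialTime, eval_add, eval_mul, eval_C, eval_ofNat, eval_X, eval_one,
    eval_pow]
  gcongr

lemma exists_polynomial_bestTime_le (A e : ℕ) :
    ∃ p : ℕ[X], ∀ n m c, c ≤ m → bestTime A e n m c ≤ p.eval (n + m) := by
  refine ⟨C e * (4 * (X + 1) + 8) + 6 * X + 15 + C A * (X + 1) ^ e *
    (C A * (X + 1) ^ e * (X * (5 * X + 13) + 10 * X + 17) + 6 * X + 7 +
      X * (5 * X + 13) + X * (5 * X + 12) + 6 * X + 21 + 3), fun n m c hcm => ?_⟩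
  have hn : n ≤ n + m := Nat.le_add_right n m
  have hm : m ≤ n + m := Nat.le_add_left m n
  have hc : c ≤ n + m := hcm.trans hm
  simp only [bestTime, attemptTime, trialTime, eval_add, eval_mul, eval_C, eval_ofNat, eval_X,
    eval_one, eval_pow]
  gcongr

end RunningTime

section SuccessProbability

variable {n m k N T : ℕ} {F : Formula n m k} {C : Finset (Fin m)} {γ a : ℝ}

lemma le_coinMeasure_exists_nthTrial_mem_good (hγ : 0 ≤ γ) (ha : 0 < a)
    (hC : ∀ j ∈ C, (F.coreDegree C j : ℝ) ≤ 2 ^ k / Real.exp 1 - 1)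
    (hD : ∀ j ∉ C, (F.coreDegree C j : ℝ) ≤ γ * (2 ^ k / Real.exp 1 - 1)) (hN : 0 < N) (R : ℕ) :
    1 - (1 / a + C.card / N) ^ R ≤ coinMeasure.real {ω | ∃ r : Fin R,
      nthTrial F C N ω r ∈ Good F C (a * ((2 : ℝ) ^ k)⁻¹ * Real.exp γ * Cᶜ.card)} := by
  refine le_of_le_of_eq ?_ (coinMeasure_real_exists_rows_mem (coreTrial F C ⁻¹'
    Good F C (a * ((2 : ℝ) ^ k)⁻¹ * Real.exp γ * Cᶜ.card)) R).symm
  gcongr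
  · exact Finset.expect_nonneg fun _ _ => Set.indicator_nonneg (fun _ _ => zero_le_one) _
  · exact expect_compl_good_coreTrial_le hγ ha hC hD hN

lemma inv_one_add_add_div_le {θ Q x c s N : ℝ} (hθ : 0 < θ) (hθQ : 1 ≤ θ * Q) (hN : 0 < N)
    (hx : x ≤ s) (hcs : (c + 1) * (Q + 1) * s ≤ N) : 1 / (1 + θ) + x / N ≤ 1 - c * s / N := by
  have hQ : 0 < Q := (pos_iff_pos_of_mul_pos (one_pos.trans_le hθQ)).1 hθ
  have hfactor : 1 / (1 + θ) ≤ 1 - 1 / (Q + 1) := by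
    rw [one_sub_div (by positivity), div_le_div_iff₀ (by positivity) (by positivity)]
    linarith
  have hsteps : (c + 1) * s / N ≤ 1 / (Q + 1) := by
    rw [div_le_div_iff₀ hN (by positivity)]
    linarith
  have hsum : x / N + c * s / N ≤ (c + 1) * s / N := by
    rw [← add_div]
    gcongr
    linarith
  linarith

lemma one_sub_mul_div_pow_le {s : ℝ} (hs : 0 < s) {c N : ℕ} (h : c * s ≤ N) :
    (1 - c * s / N) ^ N ≤ 1 / s ^ c := by
  calc (1 - c * s / N) ^ N ≤ Real.exp (-(c * s)) := Real.one_sub_div_pow_le_exp_neg h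
    _ = 1 / Real.exp s ^ c := by rw [Real.exp_neg, Real.exp_nat_mul, one_div]
    _ ≤ 1 / s ^ c := by
      gcongr
      linarith [Real.add_one_le_exp s]

lemma le_coinMeasure_output_bestProg {A e c : ℕ} {Q θ : ℝ} (hγ : 0 ≤ γ) (hθ : 0 < θ)
    (hθQ : 1 ≤ θ * Q)
    (hC : ∀ j ∈ C, (F.coreDegree C j : ℝ) ≤ 2 ^ k / Real.exp 1 - 1)
    (hD : ∀ j ∉ C, (F.coreDegree C j : ℝ) ≤ γ * (2 ^ k / Real.exp 1 - 1))
    (hA : ((c : ℝ) + 1) * (Q + 1) * (n + m + 1) ≤ A * (n + m + 1) ^ e)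
    (hT : bestTime A e n m C.card ≤ T) :
    1 - 1 / ((n : ℝ) + m + 1) ^ c ≤ coinMeasure.real {ω | output (bestProg A e) F C T ω ∈
      Good F C ((1 + θ) * ((2 : ℝ) ^ k)⁻¹ * Real.exp γ * Cᶜ.card)} := by
  set N := A * (n + m + 1) ^ e with hN
  have hQ : 0 < Q := (pos_iff_pos_of_mul_pos (one_pos.trans_le hθQ)).1 hθ
  have hNA : ((c : ℝ) + 1) * (Q + 1) * (n + m + 1) ≤ N := by
    rw [hN]
    exact_mod_cast hA
  have hN0 : (0 : ℝ) < N := lt_of_lt_of_le (by positivity) hNA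
  have hcard : (C.card : ℝ) ≤ n + m + 1 := by
    have : C.card ≤ m := by simpa using Finset.card_le_univ C
    exact_mod_cast (by omega : C.card ≤ n + m + 1)
  have hbad : (1 / (1 + θ) + C.card / N) ^ N ≤ 1 / ((n : ℝ) + m + 1) ^ c := by
    refine (pow_le_pow_left₀ (by positivity)
      (inv_one_add_add_div_le hθ hθQ hN0 hcard hNA) N).trans
      (one_sub_mul_div_pow_le (by positivity) (le_trans ?_ hNA))
    gcongr
    nlinarith [(c.cast_nonneg : (0 : ℝ) ≤ c)]
  calc 1 - 1 / ((n : ℝ) + m + 1) ^ c ≤ 1 - (1 / (1 + θ) + C.card / N) ^ N :=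
        sub_le_sub_left hbad 1
    _ ≤ _ := le_coinMeasure_exists_nthTrial_mem_good hγ (by positivity) hC hD
        (Nat.cast_pos.1 hN0) N
    _ ≤ _ := measureReal_mono (fun ω ⟨r, hr⟩ => output_bestProg_mem_good hN hT r.2 hr)
        (by finiteness)

lemma le_coinMeasure_output_singleProg {c : ℕ} {ρ : ℝ} (hγ : 0 ≤ γ) (hρ : 0 < ρ)
    (hC : ∀ j ∈ C, (F.coreDegree C j : ℝ) ≤ 2 ^ k / Real.exp 1 - 1)
    (hD : ∀ j ∉ C, (F.coreDegree C j : ℝ) ≤ γ * (2 ^ k / Real.exp 1 - 1))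
    (hT : singleTime (c + 1) n C.card ≤ T) :
    1 - ρ - 1 / ((n : ℝ) + C.card + 1) ^ c ≤
      coinMeasure.real {ω | output (singleProg (c + 1)) F C T ω ∈
        Good F C ((1 / ρ) * ((2 : ℝ) ^ k)⁻¹ * Real.exp γ * Cᶜ.card)} := by
  set N := (n + C.card + 1) ^ (c + 1) with hN
  have hcard : (C.card : ℝ) / N ≤ 1 / ((n : ℝ) + C.card + 1) ^ c := by
    rw [div_le_div_iff₀ (by positivity) (by positivity), one_mul, hN]
    push_cast
    rw [pow_succ']
    gcongr
    linarith [(n.cast_nonneg : (0 : ℝ) ≤ n)]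
  calc 1 - ρ - 1 / ((n : ℝ) + C.card + 1) ^ c ≤ 1 - (1 / (1 / ρ) + C.card / N) ^ 1 := by
        rw [pow_one, one_div_one_div]
        linarith
    _ ≤ _ := le_coinMeasure_exists_nthTrial_mem_good hγ (by positivity) hC hD (by positivity) 1
    _ ≤ _ := measureReal_mono (fun ω ⟨r, hr⟩ => ?_) (by finiteness)
  rw [Subsingleton.elim r 0] at hr
  rw [Set.mem_ofPred_eq, output_singleProg hN hT]
  exact hr

end SuccessProbability

end RandRAM

theorem lemma7p1 :
    -- the approximation factor `1 + θ`, for every `θ ≥ 1 / q(n + m)`, with high probability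
    (∀ (q : Polynomial ℕ) (c : ℕ), ∃ (P : RandRAM.Prog) (p : Polynomial ℕ),
      ∀ (n m k : ℕ) (F : Formula n m k) (C : Finset (Fin m)),
        RandRAM.HaltsWithin P (RandRAM.input F C) (p.eval (n + m)) ∧
        ∀ γ θ : ℝ, 0 ≤ γ → 0 < θ → 1 ≤ θ * (q.eval (n + m) : ℕ) →
          (∀ j ∈ C, (F.coreDegree C j : ℝ) ≤ 2 ^ k / Real.exp 1 - 1) →
          (∀ j ∉ C, (F.coreDegree C j : ℝ) ≤ γ * (2 ^ k / Real.exp 1 - 1)) →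
          1 - 1 / ((n : ℝ) + m + 1) ^ c ≤
            RandRAM.coinMeasure.real {ω |
              let σ := RandRAM.output P F C (p.eval (n + m)) ω
              (∀ j ∈ C, (F j).Satisfied σ) ∧
              (F.violatedOutside C σ : ℝ) ≤
                (1 + θ) * ((2 : ℝ) ^ k)⁻¹ * Real.exp γ * (Cᶜ.card : ℝ)}) ∧
    -- the factor `1 / ρ` with constant probability, in time polynomial in `n` and `|C|` only
    (∀ c : ℕ, ∃ (P : RandRAM.Prog) (p : Polynomial ℕ),
      ∀ (n m k : ℕ) (F : Formula n m k) (C : Finset (Fin m)),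
        RandRAM.HaltsWithin P (RandRAM.input F C) (p.eval (n + C.card)) ∧
        ∀ γ ρ : ℝ, 0 ≤ γ → 0 < ρ →
          (∀ j ∈ C, (F.coreDegree C j : ℝ) ≤ 2 ^ k / Real.exp 1 - 1) →
          (∀ j ∉ C, (F.coreDegree C j : ℝ) ≤ γ * (2 ^ k / Real.exp 1 - 1)) →
          1 - ρ - 1 / ((n : ℝ) + C.card + 1) ^ c ≤
            RandRAM.coinMeasure.real {ω |
              let σ := RandRAM.output P F C (p.eval (n + C.card)) ω
              (∀ j ∈ C, (F j).Satisfied σ) ∧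
              (F.violatedOutside C σ : ℝ) ≤
                (1 / ρ) * ((2 : ℝ) ^ k)⁻¹ * Real.exp γ * (Cᶜ.card : ℝ)}) := by
  open RandRAM in
  refine ⟨fun q c => ?_, fun c => ?_⟩
  · let A := (c + 1) * (q.eval 1 + 1)
    let e := q.natDegree + 1
    obtain ⟨p, hp⟩ := exists_polynomial_bestTime_le A e
    refine ⟨bestProg A e, p, fun n m k F C => ?_⟩
    have hT := hp n m C.card (by simpa using Finset.card_le_univ C)
    refine ⟨haltsWithin_bestProg hT, fun γ θ hγ hθ hθq hC hD =>
      le_coinMeasure_output_bestProg hγ hθ hθq hC hD ?_ hT⟩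
    have hA : (c + 1) * (q.eval (n + m) + 1) * (n + m + 1) ≤ A * (n + m + 1) ^ e := by
      simpa only [A, e, mul_assoc] using Nat.mul_le_mul_left (c + 1) (eval_add_one_mul_le q (n + m))
    exact_mod_cast hA
  · obtain ⟨p, hp⟩ := exists_polynomial_singleTime_le (c + 1)
    exact ⟨singleProg (c + 1), p, fun n m k F C => ⟨haltsWithin_singleProg (hp _ _),
      fun γ ρ hγ hρ hC hD => le_coinMeasure_output_singleProg hγ hρ hC hD (hp _ _)⟩⟩
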